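/- Let $m$ be Lebesgue measure on $[0,1]$, and let $BV$ be the space of $f\in L^1(m)$ with $V(f)=\inf\{\operatorname{var}\bar f:\bar f=f\ m\text{-a.e.}\}<\infty$, where $\operatorname{var}\bar f$ is the total variation of $\bar f$ on $[0,1]$, with norm $\|f\|_{BV}=V(f)+\|f\|_{L^1(m)}$. For a measurable map $T:[0,1]\to[0,1]$ with $T_*m\ll m$, let $P_T$ be its transfer operator on $L^1(m)$, i.e. $\int (P_Tf)\,g\,dm=\int f\cdot (g\circ T)\,dm$ for $f\in L^1(m)$, $g\in L^\infty(m)$. Let $\mathcal C$ be a class of measurable maps $T:[0,1]\to[0,1]$ with the following properties. (1) There are an integer $r\ge 1$ and constants $0<\rho<1$, $M_0,C_r>0$ such that for all $f\in BV$, $\|P_Tf\|_{BV}\le M_0\|f\|_{BV}$ for all $T\in\mathcal C$, and $\|P_{T_r}\cdots P_{T_1}f\|_{BV}\le \rho\|f\|_{BV}+C_r\|f\|_{L^1(m)}$ for all $T_1,\dots,T_r\in\mathcal C$. (2) There are $0\le\theta<1$ and $K>0$ such that $\|P_{T_l}\cdots P_{T_1}f\|_{BV}\le K\theta^l\|f\|_{BV}$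 for all $l\ge1$, all $T_1,\dots,T_l\in\mathcal C$ and all $f\in BV$ with $\int f\,dm=0$. (3) There are $\lambda>1$, $M\ge1$ and $N\ge1$ such that for each $T\in\mathcal C$ there are $k\le N$ and points $0=a_0<\dots<a_k=1$ such that, for each $i<k$, $T$ coincides on $(a_i,a_{i+1})$ with a map of class $C^2$ on a neighbourhood of $[a_i,a_{i+1}]$, and $|T'|\ge\lambda$ and $|T''|\le M$ on $(a_i,a_{i+1})$. Let $(T_n)_{n\ge1}$ be a sequence in $\mathcal C$, put $T_1^0=\mathrm{id}$ and $T_1^k=T_k\circ\cdots\circ T_1$, and suppose that there is $\delta>0$ with $P_{T_1^n}\mathbf 1\ge\delta$ $m$-a.e. for all $n\ge1$. Then there exist constants $C_1,C_2>0$ such that for every measurable $A\subseteq[0,1]$ with $m(A)>0$, every $n\ge1$ and every $t>0$, the function $$Z_n(x)=\inf_{y\in A}\frac1n\sum_{k=0}^{n-1}|T_1^kx-T_1^ky|$$ satisfies $$m\left(Z_n>C_1\frac{\sqrt{|\log m(A)|}}{\sqrt n}+\frac t{\sqrt n}\right)\le e^{-C_2t^2}.$$ -/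

import Mathlib

open MeasureTheory Set
open scoped ENNReal NNReal

namespace SeqDyn

noncomputable section

/-- Lebesgue measure `m` on the unit interval `[0,1]`, as a measure on `ℝ`.
Maps of `[0,1]` are represented by functions `ℝ → ℝ` mapping `[0,1]` to itself; their values
outside `[0,1]` play no role. -/
def leb01 : Measure ℝ := volume.restrict (Icc 0 1)

/-- The composition `T_1^n = T_n ∘ ... ∘ T_1` (with `T_1^0 = id`) of a sequence `(T_n)_{n ≥ 1}`;
the entry `T 0` is never used. -/
def seqIter (T : ℕ → ℝ → ℝ) : ℕ → ℝ → ℝ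
  | 0 => id
  | n + 1 => T (n + 1) ∘ seqIter T n

/-- The transfer operator `P_T` on `L¹(m)`: `P_T f` is the density with respect to `m` of the
push-forward under `T` of the signed measure `f m`. For measurable non-singular `T` and `f ∈ L¹(m)`
it is the `m`-a.e. unique integrable function with `∫ (P_T f) g dm = ∫ f (g ∘ T) dm` for all
bounded measurable `g`. -/
def transferOp (T : ℝ → ℝ) (f : ℝ → ℝ) : ℝ → ℝ :=
  SignedMeasure.rnDeriv ((leb01.withDensityᵥ f).map T) leb01

/-- The composition `P_{T_n} ... P_{T_1}` of transfer operators. -/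
def transferSeq (T : ℕ → ℝ → ℝ) : ℕ → (ℝ → ℝ) → (ℝ → ℝ)
  | 0, f => f
  | n + 1, f => transferOp (T (n + 1)) (transferSeq T n f)

/-- The variation `V f = inf {var f' : f' = f m-a.e.}` of the `m`-class of `f` on `[0,1]`. -/
def essVar (f : ℝ → ℝ) : ℝ≥0∞ :=
  ⨅ (g : ℝ → ℝ) (_ : g =ᵐ[leb01] f), eVariationOn g (Icc 0 1)

/-- The `BV` norm `V f + ‖f‖_{L¹(m)}`, with values in `[0,∞]`. -/
def bvNorm (f : ℝ → ℝ) : ℝ≥0∞ := essVar f + eLpNorm f 1 leb01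

/-- Membership in `BV`: `f ∈ L¹(m)` and `V f < ∞`. -/
def IsBV (f : ℝ → ℝ) : Prop := Integrable f leb01 ∧ essVar f < ∞

/-- `T : [0,1] → [0,1]` is measurable and `C²` on each piece of the finite partition of `[0,1]`
given by the points `0 = a 0 < a 1 < ... < a k = 1`: on each interval `(a i, a (i+1))` it coincides
with a map that is `C²` on a neighbourhood of `[a i, a (i+1)]`. -/
structure IsPiecewiseC2 (T : ℝ → ℝ) (k : ℕ) (a : Fin (k + 1) → ℝ) : Prop where
  measurable : Measurable T
  mapsTo : MapsTo T (Icc 0 1) (Icc 0 1)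
  strictMono : StrictMono a
  first : a 0 = 0
  last : a (Fin.last k) = 1
  extends_C2 : ∀ i : Fin k, ∃ (U : Set ℝ) (S : ℝ → ℝ), IsOpen U ∧
    Icc (a i.castSucc) (a i.succ) ⊆ U ∧ ContDiffOn ℝ 2 S U ∧
    EqOn T S (Ioo (a i.castSucc) (a i.succ))

/-- Condition `(D_r)`: the transfer operators of the maps of the class `C` are uniformly bounded on
`BV`, and all compositions of `r` of them satisfy a uniform Lasota-Yorke inequality. -/
def ConditionD (C : Set (ℝ → ℝ)) (r : ℕ) : Prop :=
  ∃ ρ M₀ Cr : ℝ≥0, 0 < ρ ∧ ρ < 1 ∧ 0 < M₀ ∧ 0 < Cr ∧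
    (∀ T ∈ C, ∀ f, IsBV f → bvNorm (transferOp T f) ≤ M₀ * bvNorm f) ∧
    (∀ T : ℕ → ℝ → ℝ, (∀ j, 1 ≤ j → T j ∈ C) → ∀ f, IsBV f →
      bvNorm (transferSeq T r f) ≤ ρ * bvNorm f + Cr * eLpNorm f 1 leb01)

/-- The decorrelation property (Dec) of the class `C`: uniform exponential decay in `BV` norm of
compositions of transfer operators on `BV` functions with zero average. -/
def ConditionDec (C : Set (ℝ → ℝ)) : Prop :=
  ∃ θ K : ℝ≥0, θ < 1 ∧ 0 < K ∧
    ∀ l : ℕ, 1 ≤ l → ∀ T : ℕ → ℝ → ℝ, (∀ j, 1 ≤ j → T j ∈ C) →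
      ∀ f, IsBV f → ∫ x, f x ∂leb01 = 0 →
        bvNorm (transferSeq T l f) ≤ K * θ ^ l * bvNorm f

/-- The standing assumptions on a class `C` of piecewise expanding maps of `[0,1]`. -/
structure IsAdmissibleClass (C : Set (ℝ → ℝ)) : Prop where
  condD : ∃ r : ℕ, 1 ≤ r ∧ ConditionD C r
  condDec : ConditionDec C
  /-- Uniform bounds on the number of branches, the expansion and the second derivative. -/
  uniform : ∃ (lam M : ℝ) (N : ℕ), 1 < lam ∧ 1 ≤ M ∧ 1 ≤ N ∧
    ∀ T ∈ C, ∃ (k : ℕ) (a : Fin (k + 1) → ℝ), k ≤ N ∧ IsPiecewiseC2 T k a ∧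
      ∀ i : Fin k, ∀ x ∈ Ioo (a i.castSucc) (a i.succ),
        lam ≤ |deriv T x| ∧ |deriv (deriv T) x| ≤ M

/-- The minoration condition (Min) on the sequence `(T_n)_{n ≥ 1}`: there is `δ > 0` with
`P_1^n 1 ≥ δ` for all `n`. -/
def ConditionMin (T : ℕ → ℝ → ℝ) : Prop :=
  ∃ δ : ℝ, 0 < δ ∧ ∀ n : ℕ, 1 ≤ n →
    ∀ᵐ x ∂leb01, δ ≤ transferOp (seqIter T n) (fun _ => 1) x

/-- `Z_n(x) = inf_{y ∈ A} (1/n) ∑_{k < n} |T_1^k x - T_1^k y|`. -/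
def shadow (T : ℕ → ℝ → ℝ) (A : Set ℝ) (n : ℕ) (x : ℝ) : ℝ :=
  ⨅ y : A, (1 / (n : ℝ)) * ∑ k ∈ Finset.range n, |seqIter T k x - seqIter T k y|

end

end SeqDyn

/-!
`Z_n` is a `1`-Lipschitz function, for the mean distance of the first `n` points, of the orbit of
`x`. Expand it in reverse martingale differences for the decreasing σ-algebras `𝓑 p` generated by
`T_1^p`. Conditionally on the future of `T_1^p x`, the past is distributed almost as it is without
conditioning: replacing the past one coordinate at a time, the coordinate `T_1^i x` contributes
`O(1 / n)` times the correlation between an observable of the first `i` steps, which is Lipschitz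
along the branches of `T_1^i`, and a function of `T_1^p x`. The transfer operator of `T_1^i` maps
such observables boundedly into `BV`, since the sum over the branches of `sup 1 / |(T_1^i)'|` is
bounded in `i`, so that by (Dec) and (Min) this correlation is `O(θ ^ (p - i))`, relatively to the
measure of the conditioning event. Hence the martingale differences are `O(1 / n)`, and `Z_n` is
sub-Gaussian with variance proxy `O(1 / n)`. Since `Z_n` vanishes on `A`, the lower tail of `Z_n`
has measure at least `m A` at depth `∫ Z_n`, which bounds the mean by
`O(√|log (m A)| / √n)`.
-/

namespace SeqDyn

/-! ### Transfer operators -/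

section TransferOperator

instance : IsProbabilityMeasure leb01 := by
  constructor
  simp [leb01]

theorem ae_mem_Icc : ∀ᵐ x ∂leb01, x ∈ Icc (0 : ℝ) 1 :=
  ae_restrict_mem measurableSet_Icc

theorem abs_sub_le_one {x y : ℝ} (hx : x ∈ Icc (0 : ℝ) 1) (hy : y ∈ Icc (0 : ℝ) 1) :
    |x - y| ≤ 1 :=
  abs_sub_le_iff.2 ⟨by linarith [hx.2, hy.1], by linarith [hx.1, hy.2]⟩

/-- Non-singular maps of `[0,1]`, the maps for which the transfer operator is a density: the
preimage of a Lebesgue null set is a null set. -/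
structure IsNonsingular (S : ℝ → ℝ) : Prop where
  quasiMeasurePreserving : Measure.QuasiMeasurePreserving S leb01 leb01
  mapsTo : MapsTo S (Icc 0 1) (Icc 0 1)

namespace IsNonsingular

variable {S : ℝ → ℝ}

theorem measurable (hS : IsNonsingular S) : Measurable S :=
  hS.quasiMeasurePreserving.measurable

theorem id : IsNonsingular id :=
  ⟨.id leb01, mapsTo_id _⟩

theorem comp {R : ℝ → ℝ} (hR : IsNonsingular R) (hS : IsNonsingular S) : IsNonsingular (R ∘ S) :=
  ⟨hR.quasiMeasurePreserving.comp hS.quasiMeasurePreserving, hR.mapsTo.comp hS.mapsTo⟩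

theorem seqIter {T : ℕ → ℝ → ℝ} (hT : ∀ j, 1 ≤ j → IsNonsingular (T j)) (n : ℕ) :
    IsNonsingular (seqIter T n) := by
  induction n with
  | zero => exact .id
  | succ n ih => exact (hT (n + 1) n.succ_pos).comp ih

end IsNonsingular

variable {S f g h : ℝ → ℝ}

theorem integrable_transferOp (S f : ℝ → ℝ) : Integrable (transferOp S f) leb01 :=
  SignedMeasure.integrable_rnDeriv _ _

theorem setIntegral_transferOp (hS : IsNonsingular S) (hf : Integrable f leb01) {B : Set ℝ}
    (hB : MeasurableSet B) :
    ∫ x in B, transferOp S f x ∂leb01 = ∫ x in S ⁻¹' B, f x ∂leb01 := by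
  have hac : (leb01.withDensityᵥ f).map S ≪ᵥ leb01.toENNRealVectorMeasure := by
    refine VectorMeasure.AbsolutelyContinuous.mk fun s hs h0 => ?_
    rw [Measure.toENNRealVectorMeasure_apply_measurable hs] at h0
    rw [VectorMeasure.map_apply _ hS.measurable hs, withDensityᵥ_apply hf (hS.measurable hs)]
    exact setIntegral_measure_zero _ (hS.quasiMeasurePreserving.preimage_null h0)
  have hdensity : leb01.withDensityᵥ (transferOp S f) B = (leb01.withDensityᵥ f).map S B :=
    congrArg (fun ν : SignedMeasure ℝ => ν B) (SignedMeasure.withDensityᵥ_rnDeriv_eq _ _ hac)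
  rwa [withDensityᵥ_apply (integrable_transferOp S f) hB,
    VectorMeasure.map_apply _ hS.measurable hB,
    withDensityᵥ_apply hf (hS.measurable hB)] at hdensity

theorem transferOp_ae_eq (hS : IsNonsingular S) (hf : Integrable f leb01)
    (hh : Integrable h leb01)
    (H : ∀ B, MeasurableSet B → ∫ x in B, h x ∂leb01 = ∫ x in S ⁻¹' B, f x ∂leb01) :
    transferOp S f =ᵐ[leb01] h :=
  Integrable.ae_eq_of_forall_setIntegral_eq _ _ (integrable_transferOp S f) hh
    fun B hB _ => by rw [setIntegral_transferOp hS hf hB, H B hB]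

theorem transferOp_sub_ae_eq (hS : IsNonsingular S) (hf : Integrable f leb01)
    (hg : Integrable g leb01) :
    transferOp S (f - g) =ᵐ[leb01] transferOp S f - transferOp S g := by
  refine transferOp_ae_eq hS (hf.sub hg)
    ((integrable_transferOp S f).sub (integrable_transferOp S g)) fun B hB => ?_
  simp only [Pi.sub_apply]
  rw [integral_sub (integrable_transferOp S f).integrableOn
    (integrable_transferOp S g).integrableOn, integral_sub hf.integrableOn hg.integrableOn,
    setIntegral_transferOp hS hf hB, setIntegral_transferOp hS hg hB]

theorem integral_transferOp (hS : IsNonsingular S) (hf : Integrable f leb01) :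
    ∫ x, transferOp S f x ∂leb01 = ∫ x, f x ∂leb01 := by
  simpa using setIntegral_transferOp hS hf MeasurableSet.univ

variable {T : ℕ → ℝ → ℝ}

theorem integrable_transferSeq (T : ℕ → ℝ → ℝ) (hf : Integrable f leb01) (n : ℕ) :
    Integrable (transferSeq T n f) leb01 := by
  cases n with
  | zero => exact hf
  | succ n => exact integrable_transferOp _ _

theorem setIntegral_transferSeq (hT : ∀ j, 1 ≤ j → IsNonsingular (T j))
    (hf : Integrable f leb01) (n : ℕ) {B : Set ℝ} (hB : MeasurableSet B) :
    ∫ x in B, transferSeq T n f x ∂leb01 = ∫ x in seqIter T n ⁻¹' B, f x ∂leb01 := by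
  induction n generalizing B with
  | zero => rfl
  | succ n ih =>
    have hTn := hT (n + 1) n.succ_pos
    rw [transferSeq, setIntegral_transferOp hTn (integrable_transferSeq T hf n) hB,
      ih (hTn.measurable hB)]
    rfl

theorem transferOp_seqIter_ae_eq (hT : ∀ j, 1 ≤ j → IsNonsingular (T j))
    (hf : Integrable f leb01) (n : ℕ) :
    transferOp (seqIter T n) f =ᵐ[leb01] transferSeq T n f :=
  transferOp_ae_eq (.seqIter hT n) hf (integrable_transferSeq T hf n)
    fun _ hB => setIntegral_transferSeq hT hf n hB

theorem transferSeq_add (T : ℕ → ℝ → ℝ) (i l : ℕ) (f : ℝ → ℝ) :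
    transferSeq T (i + l) f = transferSeq (fun j => T (j + i)) l (transferSeq T i f) := by
  induction l with
  | zero => rfl
  | succ l ih =>
    rw [← add_assoc, transferSeq, transferSeq, ih]
    congr 2
    omega

end TransferOperator

/-! ### The `BV` norm -/

section BVNorm

variable {f g : ℝ → ℝ}

theorem essVar_le (h : g =ᵐ[leb01] f) : essVar f ≤ eVariationOn g (Icc 0 1) :=
  iInf₂_le g h

theorem essVar_congr (h : f =ᵐ[leb01] g) : essVar f = essVar g :=
  le_antisymm (le_iInf₂ fun _ hu => essVar_le (hu.trans h.symm))
    (le_iInf₂ fun _ hu => essVar_le (hu.trans h))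

theorem bvNorm_congr (h : f =ᵐ[leb01] g) : bvNorm f = bvNorm g := by
  rw [bvNorm, bvNorm, essVar_congr h, eLpNorm_congr_ae h]

theorem essVar_sub_const_le (f : ℝ → ℝ) (c : ℝ) : essVar (fun x => f x - c) ≤ essVar f := by
  refine le_iInf₂ fun g hg => (essVar_le (g := fun x => g x - c) ?_).trans_eq ?_
  · filter_upwards [hg] with x hx
    rw [hx]
  · simp [eVariationOn]

theorem ae_enorm_le_eVariationOn_add (h : g =ᵐ[leb01] f) :
    ∀ᵐ x ∂leb01, ‖f x‖ₑ ≤ eVariationOn g (Icc 0 1) + eLpNorm f 1 leb01 := by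
  filter_upwards [h, ae_mem_Icc] with x hx hx01
  have hosc : ∀ᵐ y ∂leb01, ‖g x‖ₑ ≤ eVariationOn g (Icc 0 1) + ‖f y‖ₑ := by
    filter_upwards [h, ae_mem_Icc] with y hy hy01
    calc ‖g x‖ₑ = ‖(g x - g y) + g y‖ₑ := by rw [sub_add_cancel]
      _ ≤ ‖g x - g y‖ₑ + ‖g y‖ₑ := enorm_add_le _ _
      _ ≤ eVariationOn g (Icc 0 1) + ‖f y‖ₑ := by
        rw [← hy, ← edist_eq_enorm_sub]
        gcongr
        exact eVariationOn.edist_le g hx01 hy01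
  have hmean := lintegral_mono_ae hosc
  rwa [lintegral_add_left measurable_const, lintegral_const, lintegral_const, measure_univ,
    mul_one, mul_one, ← eLpNorm_one_eq_lintegral_enorm, hx] at hmean

theorem ae_enorm_le_bvNorm (f : ℝ → ℝ) : ∀ᵐ x ∂leb01, ‖f x‖ₑ ≤ bvNorm f := by
  have hsup : eLpNormEssSup f leb01 ≤ bvNorm f := by
    simp only [bvNorm, essVar, ENNReal.iInf_add]
    exact le_iInf₂ fun g hg => essSup_le_of_ae_le _ (ae_enorm_le_eVariationOn_add hg)
  filter_upwards [enorm_ae_le_eLpNormEssSup f leb01] with x hx using hx.trans hsup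

theorem ae_abs_le_of_bvNorm_le {f : ℝ → ℝ} {b : ℝ} (hb : 0 ≤ b)
    (h : bvNorm f ≤ ENNReal.ofReal b) : ∀ᵐ x ∂leb01, |f x| ≤ b := by
  filter_upwards [ae_enorm_le_bvNorm f] with x hx
  have h1 := hx.trans h
  rwa [Real.enorm_eq_ofReal_abs, ENNReal.ofReal_le_ofReal_iff hb] at h1

end BVNorm

/-! ### Branches -/

section Branch

variable {S T : ℝ → ℝ} {lam M c : ℝ} {I J : Set ℝ}

theorem mul_abs_sub_le_of_le_abs_deriv (hJ : J.OrdConnected)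
    (hd : ∀ x ∈ J, DifferentiableAt ℝ T x) (hl : ∀ x ∈ J, lam ≤ |deriv T x|)
    {x y : ℝ} (hx : x ∈ J) (hy : y ∈ J) : lam * |x - y| ≤ |T x - T y| := by
  wlog hxy : x < y generalizing x y
  · rcases eq_or_lt_of_le (not_lt.1 hxy) with rfl | h
    · simp
    · rw [abs_sub_comm x, abs_sub_comm (T x)]
      exact this hy hx h
  have hsub : Icc x y ⊆ J := hJ.out hx hy
  obtain ⟨z, hz, hslope⟩ := exists_deriv_eq_slope T hxy
    (fun w hw => (hd w (hsub hw)).continuousAt.continuousWithinAt)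
    (fun w hw => (hd w (hsub (Ioo_subset_Icc_self hw))).differentiableWithinAt)
  have hlz := hl z (hsub (Ioo_subset_Icc_self hz))
  rw [hslope, abs_div, le_div_iff₀ (abs_pos.2 (sub_pos.2 hxy).ne')] at hlz
  rwa [abs_sub_comm x, abs_sub_comm (T x)]

/-- `T` is differentiable on the open interval `J`, with `|T'| ≥ lam` and with `log |T'|`
Lipschitz with constant `M`. -/
structure ExpandingOn (T : ℝ → ℝ) (lam M : ℝ) (J : Set ℝ) : Prop where
  isOpen : IsOpen J
  ordConnected : J.OrdConnected
  differentiableAt : ∀ x ∈ J, DifferentiableAt ℝ T x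
  le_abs_deriv : ∀ x ∈ J, lam ≤ |deriv T x|
  distortion : ∀ x ∈ J, ∀ y ∈ J, |deriv T x| ≤ |deriv T y| * Real.exp (M * |x - y|)

theorem ExpandingOn.mul_abs_sub_le (h : ExpandingOn T lam M J) {x y : ℝ} (hx : x ∈ J)
    (hy : y ∈ J) : lam * |x - y| ≤ |T x - T y| :=
  mul_abs_sub_le_of_le_abs_deriv h.ordConnected h.differentiableAt h.le_abs_deriv hx hy

theorem IsPiecewiseC2.expandingOn {k : ℕ} {a : Fin (k + 1) → ℝ} (h : IsPiecewiseC2 T k a)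
    (hlam : 1 ≤ lam) (i : Fin k)
    (hb : ∀ x ∈ Ioo (a i.castSucc) (a i.succ), lam ≤ |deriv T x| ∧ |deriv (deriv T) x| ≤ M) :
    ExpandingOn T lam M (Ioo (a i.castSucc) (a i.succ)) := by
  obtain ⟨U, S, -, hsub, hS, hTS⟩ := h.extends_C2 i
  have hT : ContDiffOn ℝ 2 T (Ioo (a i.castSucc) (a i.succ)) :=
    (hS.mono (Ioo_subset_Icc_self.trans hsub)).congr hTS
  have hT' : ContDiffOn ℝ 1 (deriv T) (Ioo (a i.castSucc) (a i.succ)) :=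
    hT.deriv_of_isOpen isOpen_Ioo (by norm_num)
  refine ⟨isOpen_Ioo, ordConnected_Ioo,
    fun x hx => (hT.contDiffAt (isOpen_Ioo.mem_nhds hx)).differentiableAt (by norm_num),
    fun x hx => (hb x hx).1, fun x hx y hy => ?_⟩
  have hlip : |deriv T x - deriv T y| ≤ M * |x - y| :=
    Convex.norm_image_sub_le_of_norm_deriv_le (f := deriv T)
      (fun z hz => (hT'.contDiffAt (isOpen_Ioo.mem_nhds hz)).differentiableAt (by norm_num))
      (fun z hz => (hb z hz).2) (convex_Ioo _ _) hy hx
  have hy1 : 1 ≤ |deriv T y| := hlam.trans (hb y hy).1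
  have hM : 0 ≤ M * |x - y| := (abs_nonneg _).trans hlip
  calc |deriv T x| ≤ |deriv T y| + M * |x - y| := by
        linarith [abs_sub_abs_le_abs_sub (deriv T x) (deriv T y)]
    _ ≤ |deriv T y| * (M * |x - y| + 1) := by nlinarith
    _ ≤ |deriv T y| * Real.exp (M * |x - y|) := by gcongr; exact Real.add_one_le_exp _

/-- `I` is an open subinterval of `[0,1]` on which `S` is differentiable with `|S'| ≥ 1`, and
`log |S'|`, read as a function of the image point, is Lipschitz with constant `c`. Measuring the
distortion in the image makes the constant stable under composition, see `IsBranch.comp`. -/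
structure IsBranch (S : ℝ → ℝ) (c : ℝ) (I : Set ℝ) : Prop where
  isOpen : IsOpen I
  ordConnected : I.OrdConnected
  subset : I ⊆ Icc 0 1
  mapsTo : MapsTo S I (Icc 0 1)
  differentiableAt : ∀ x ∈ I, DifferentiableAt ℝ S x
  one_le_abs_deriv : ∀ x ∈ I, 1 ≤ |deriv S x|
  distortion : ∀ x ∈ I, ∀ y ∈ I, |deriv S x| ≤ |deriv S y| * Real.exp (c * |S x - S y|)

namespace IsBranch

theorem id_Ioo (hc : 0 ≤ c) : IsBranch id c (Ioo 0 1) where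
  isOpen := isOpen_Ioo
  ordConnected := ordConnected_Ioo
  subset := Ioo_subset_Icc_self
  mapsTo := Ioo_subset_Icc_self
  differentiableAt x _ := differentiableAt_id
  one_le_abs_deriv x _ := by simp
  distortion x _ y _ := by
    simp only [deriv_id, abs_one, one_mul]
    exact Real.one_le_exp (by positivity)

theorem measurableSet (h : IsBranch S c I) : MeasurableSet I :=
  h.isOpen.measurableSet

theorem abs_deriv_pos (h : IsBranch S c I) {x : ℝ} (hx : x ∈ I) : 0 < |deriv S x| :=
  one_pos.trans_le (h.one_le_abs_deriv x hx)

theorem continuousOn (h : IsBranch S c I) : ContinuousOn S I :=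
  fun x hx => (h.differentiableAt x hx).continuousAt.continuousWithinAt

theorem abs_sub_le (h : IsBranch S c I) {x y : ℝ} (hx : x ∈ I) (hy : y ∈ I) :
    |x - y| ≤ |S x - S y| := by
  simpa using mul_abs_sub_le_of_le_abs_deriv h.ordConnected h.differentiableAt
    h.one_le_abs_deriv hx hy

theorem injOn (h : IsBranch S c I) : InjOn S I := fun x hx y hy hxy =>
  sub_eq_zero.1 <| abs_nonpos_iff.1 <| by simpa [hxy] using h.abs_sub_le hx hy

theorem strictMonoOn_or_strictAntiOn (h : IsBranch S c I) {x y : ℝ} (hx : x ∈ I) (hy : y ∈ I)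
    (hxy : x ≤ y) : StrictMonoOn S (Icc x y) ∨ StrictAntiOn S (Icc x y) :=
  ContinuousOn.strictMonoOn_of_injOn_Icc' hxy (h.continuousOn.mono (h.ordConnected.out hx hy))
    (h.injOn.mono (h.ordConnected.out hx hy))

theorem ordConnected_image (h : IsBranch S c I) : (S '' I).OrdConnected :=
  (h.ordConnected.isPreconnected.image _ h.continuousOn).ordConnected

theorem image_mem_nhds (h : IsBranch S c I) {x : ℝ} (hx : x ∈ I) : S '' I ∈ nhds (S x) := by
  obtain ⟨u, v, ⟨hux, hxv⟩, huv⟩ :=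
    (mem_nhds_iff_exists_Ioo_subset.1 (h.isOpen.mem_nhds hx))
  obtain ⟨p, hup, hpx⟩ := exists_between hux
  obtain ⟨q, hxq, hqv⟩ := exists_between hxv
  have hp : p ∈ I := huv ⟨hup, hpx.trans hxv⟩
  have hq : q ∈ I := huv ⟨hux.trans hxq, hqv⟩
  have hpq := hpx.trans hxq
  have hx' : x ∈ Icc p q := ⟨hpx.le, hxq.le⟩
  rcases h.strictMonoOn_or_strictAntiOn hp hq hpq.le with hS | hS
  · exact Filter.mem_of_superset (Icc_mem_nhds (hS (left_mem_Icc.2 hpq.le) hx' hpx)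
      (hS hx' (right_mem_Icc.2 hpq.le) hxq))
      (h.ordConnected_image.out (mem_image_of_mem S hp) (mem_image_of_mem S hq))
  · exact Filter.mem_of_superset (Icc_mem_nhds (hS hx' (right_mem_Icc.2 hpq.le) hxq)
      (hS (left_mem_Icc.2 hpq.le) hx' hpx))
      (h.ordConnected_image.out (mem_image_of_mem S hq) (mem_image_of_mem S hp))

theorem ordConnected_inter_preimage (h : IsBranch S c I) (hJ : J.OrdConnected) :
    (I ∩ S ⁻¹' J).OrdConnected := by
  refine ⟨fun x hx z hz y hy => ⟨h.ordConnected.out hx.1 hz.1 hy, ?_⟩⟩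
  have hxz := hy.1.trans hy.2
  rcases h.strictMonoOn_or_strictAntiOn hx.1 hz.1 hxz with hS | hS
  · exact hJ.out hx.2 hz.2 ⟨hS.monotoneOn (left_mem_Icc.2 hxz) hy hy.1,
      hS.monotoneOn hy (right_mem_Icc.2 hxz) hy.2⟩
  · exact hJ.out hz.2 hx.2 ⟨hS.antitoneOn hy (right_mem_Icc.2 hxz) hy.2,
      hS.antitoneOn (left_mem_Icc.2 hxz) hy hy.1⟩

theorem abs_deriv_comp (h : IsBranch S c I) (hJ : ExpandingOn T lam M J) {x : ℝ}
    (hx : x ∈ I ∩ S ⁻¹' J) : |deriv (T ∘ S) x| = |deriv T (S x)| * |deriv S x| := by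
  rw [deriv_comp x (hJ.differentiableAt _ hx.2) (h.differentiableAt x hx.1), abs_mul]

theorem comp (h : IsBranch S c I) (hJ : ExpandingOn T lam M J)
    (hT : MapsTo T (Icc 0 1) (Icc 0 1)) (hlam : 1 ≤ lam) (hc0 : 0 ≤ c) (hc : c + M ≤ lam * c) :
    IsBranch (T ∘ S) c (I ∩ S ⁻¹' J) where
  isOpen := h.continuousOn.isOpen_inter_preimage h.isOpen hJ.isOpen
  ordConnected := h.ordConnected_inter_preimage hJ.ordConnected
  subset := inter_subset_left.trans h.subset
  mapsTo := hT.comp (h.mapsTo.mono_left inter_subset_left)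
  differentiableAt x hx := (hJ.differentiableAt _ hx.2).comp x (h.differentiableAt x hx.1)
  one_le_abs_deriv x hx := by
    rw [h.abs_deriv_comp hJ hx]
    exact one_le_mul_of_one_le_of_one_le (hlam.trans (hJ.le_abs_deriv _ hx.2))
      (h.one_le_abs_deriv x hx.1)
  distortion x hx y hy := by
    have hexp : (M + c) * |S x - S y| ≤ c * |T (S x) - T (S y)| := calc
      (M + c) * |S x - S y| ≤ c * (lam * |S x - S y|) := by
        nlinarith [mul_le_mul_of_nonneg_right hc (abs_nonneg (S x - S y))]
      _ ≤ c * |T (S x) - T (S y)| := by gcongr; exact hJ.mul_abs_sub_le hx.2 hy.2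
    rw [h.abs_deriv_comp hJ hx, h.abs_deriv_comp hJ hy]
    calc |deriv T (S x)| * |deriv S x|
        ≤ (|deriv T (S y)| * Real.exp (M * |S x - S y|)) *
          (|deriv S y| * Real.exp (c * |S x - S y|)) := by
          gcongr
          · exact hJ.distortion _ hx.2 _ hy.2
          · exact h.distortion x hx.1 y hy.1
      _ = |deriv T (S y)| * |deriv S y| * Real.exp ((M + c) * |S x - S y|) := by
          rw [add_mul, Real.exp_add]
          ring
      _ ≤ |deriv T (S y)| * |deriv S y| * Real.exp (c * |(T ∘ S) x - (T ∘ S) y|) := by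
          exact mul_le_mul_of_nonneg_left (Real.exp_le_exp.2 hexp) (by positivity)

theorem inv_abs_deriv_le_mul_exp_abs_sub (h : IsBranch S c I) {x y : ℝ} (hx : x ∈ I)
    (hy : y ∈ I) : |deriv S x|⁻¹ ≤ |deriv S y|⁻¹ * Real.exp (c * |S x - S y|) := by
  have hdist := h.distortion y hy x hx
  rw [abs_sub_comm] at hdist
  rw [inv_mul_eq_div, inv_eq_one_div, div_le_div_iff₀ (h.abs_deriv_pos hx) (h.abs_deriv_pos hy)]
  linarith

theorem inv_abs_deriv_le_exp_mul (h : IsBranch S c I) (hc : 0 ≤ c) {x y : ℝ} (hx : x ∈ I)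
    (hy : y ∈ I) : |deriv S x|⁻¹ ≤ Real.exp c * |deriv S y|⁻¹ := by
  rw [mul_comm]
  refine (h.inv_abs_deriv_le_mul_exp_abs_sub hx hy).trans ?_
  gcongr
  exact mul_le_of_le_one_right hc (abs_sub_le_one (h.mapsTo hx) (h.mapsTo hy))

end IsBranch

/-- Pairwise disjoint branches of `S` that cover almost all of `[0,1]`. -/
structure IsBranchPartition {ι : Type*} (S : ℝ → ℝ) (c : ℝ) (I : ι → Set ℝ) : Prop where
  isBranch : ∀ b, IsBranch S c (I b)
  disjoint : Pairwise (Function.onFun Disjoint I)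
  cover : ∀ᵐ x ∂leb01, ∃ b, x ∈ I b

theorem IsBranchPartition.id_Ioo (hc : 0 ≤ c) :
    IsBranchPartition id c fun _ : Unit => Ioo (0 : ℝ) 1 where
  isBranch _ := .id_Ioo hc
  disjoint _ _ hab := (hab rfl).elim
  cover := by
    have hIoo : ∀ᵐ x ∂leb01, x ∈ Ioo (0 : ℝ) 1 := by
      rw [leb01, ← Measure.restrict_congr_set Ioo_ae_eq_Icc]
      exact ae_restrict_mem measurableSet_Ioo
    filter_upwards [hIoo] with x hx using ⟨(), hx⟩

end Branch

/-! ### The branch formula for the transfer operator -/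

section BranchDensity

variable {S w : ℝ → ℝ} {c : ℝ} {I : Set ℝ}

/-- The contribution of the branch of `S` on `I` to the transfer operator of `S` applied to `w`:
the function `(w / |S'|) ∘ (S|_I)⁻¹` on `S '' I`, extended by `0`. -/
noncomputable def branchDensity (S w : ℝ → ℝ) (I : Set ℝ) : ℝ → ℝ :=
  (S '' I).indicator fun x =>
    |deriv S (Function.invFunOn S I x)|⁻¹ * w (Function.invFunOn S I x)

theorem branchDensity_of_notMem (w : ℝ → ℝ) {x : ℝ} (hx : x ∉ S '' I) :
    branchDensity S w I x = 0 :=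
  indicator_of_notMem hx _

theorem branchDensity_nonneg (S : ℝ → ℝ) (hw : ∀ x, 0 ≤ w x) (I : Set ℝ) (x : ℝ) :
    0 ≤ branchDensity S w I x :=
  indicator_nonneg (fun _ _ => mul_nonneg (by positivity) (hw _)) _

namespace IsBranch

theorem branchDensity_apply (h : IsBranch S c I) (w : ℝ → ℝ) {y : ℝ} (hy : y ∈ I) :
    branchDensity S w I (S y) = |deriv S y|⁻¹ * w y := by
  rw [branchDensity, indicator_of_mem (mem_image_of_mem S hy), h.injOn.leftInvOn_invFunOn hy]

theorem abs_deriv_smul_branchDensity (h : IsBranch S c I) (w : ℝ → ℝ) {y : ℝ} (hy : y ∈ I) :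
    |deriv S y| • branchDensity S w I (S y) = w y := by
  rw [h.branchDensity_apply w hy, smul_eq_mul, mul_inv_cancel_left₀ (h.abs_deriv_pos hy).ne']

theorem hasDerivWithinAt (h : IsBranch S c I) {E : Set ℝ} (hE : E ⊆ I) {x : ℝ} (hx : x ∈ E) :
    HasDerivWithinAt S (deriv S x) E x :=
  (h.differentiableAt x (hE hx)).hasDerivAt.hasDerivWithinAt

theorem integrable_branchDensity (h : IsBranch S c I) (hw : Integrable w leb01) :
    Integrable (branchDensity S w I) leb01 := by
  have hIw : IntegrableOn w I := by
    simpa only [IntegrableOn, leb01, Measure.restrict_restrict_of_subset h.subset]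
      using hw.integrableOn (s := I)
  have himage : IntegrableOn (branchDensity S w I) (S '' I) :=
    (integrableOn_image_iff_integrableOn_abs_deriv_smul h.measurableSet
      (fun x hx => h.hasDerivWithinAt Subset.rfl hx) h.injOn _).2
      ((integrableOn_congr_fun (fun x hx => h.abs_deriv_smul_branchDensity w hx)
        h.measurableSet).2 hIw)
  exact ((integrableOn_iff_integrable_of_support_subset support_indicator_subset).1
    himage).restrict

theorem setIntegral_branchDensity (h : IsBranch S c I) (hS : Measurable S) (w : ℝ → ℝ)
    {B : Set ℝ} (hB : MeasurableSet B) :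
    ∫ x in B, branchDensity S w I x ∂leb01 = ∫ x in I ∩ S ⁻¹' B, w x ∂leb01 := by
  have hIB := h.measurableSet.inter (hS hB)
  have himage : S '' (I ∩ S ⁻¹' B) ⊆ Icc 0 1 :=
    (image_mono inter_subset_left).trans h.mapsTo.image_subset
  calc ∫ x in B, branchDensity S w I x ∂leb01
      = ∫ x in S '' (I ∩ S ⁻¹' B), branchDensity S w I x ∂leb01 := by
        rw [image_inter_preimage]
        exact setIntegral_eq_of_subset_of_forall_sdiff_eq_zero hB inter_subset_right
          fun x hx => branchDensity_of_notMem w fun hxI => hx.2 ⟨hxI, hx.1⟩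
    _ = ∫ x in S '' (I ∩ S ⁻¹' B), branchDensity S w I x := by
        rw [leb01, Measure.restrict_restrict_of_subset himage]
    _ = ∫ x in I ∩ S ⁻¹' B, |deriv S x| • branchDensity S w I (S x) :=
        integral_image_eq_integral_abs_deriv_smul hIB
          (fun x hx => h.hasDerivWithinAt inter_subset_left hx) (h.injOn.mono inter_subset_left) _
    _ = ∫ x in I ∩ S ⁻¹' B, w x :=
        setIntegral_congr_fun hIB fun x hx => h.abs_deriv_smul_branchDensity w hx.1
    _ = ∫ x in I ∩ S ⁻¹' B, w x ∂leb01 := by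
        rw [leb01, Measure.restrict_restrict_of_subset (inter_subset_left.trans h.subset)]

end IsBranch

theorem IsBranchPartition.transferOp_ae_eq {ι : Type*} [Fintype ι] {I : ι → Set ℝ}
    (h : IsBranchPartition S c I) (hS : IsNonsingular S) (hw : Integrable w leb01) :
    transferOp S w =ᵐ[leb01] fun x => ∑ b, branchDensity S w (I b) x := by
  have hint := fun b => (h.isBranch b).integrable_branchDensity hw
  refine SeqDyn.transferOp_ae_eq hS hw (integrable_finsetSum _ fun b _ => hint b) fun B hB => ?_
  have hcover : ⋃ b, I b ∩ S ⁻¹' B =ᵐ[leb01] S ⁻¹' B := by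
    filter_upwards [h.cover] with x hx
    rw [← iUnion_inter]
    exact propext (and_iff_right (mem_iUnion.2 hx))
  rw [integral_finsetSum _ fun b _ => (hint b).integrableOn]
  simp_rw [fun b => (h.isBranch b).setIntegral_branchDensity hS.measurable w hB]
  rw [← integral_iUnion_fintype
    (fun b => (h.isBranch b).measurableSet.inter (hS.measurable hB))
    (fun a b hab => (h.disjoint hab).mono inter_subset_left inter_subset_left)
    (fun b => hw.integrableOn)]
  exact setIntegral_congr_set hcover

end BranchDensity

/-! ### Piecewise expanding maps -/

section Partition

variable {S T : ℝ → ℝ} {lam M c : ℝ} {N k : ℕ} {a : Fin (k + 1) → ℝ}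

/-- The `l`-th open interval of the partition of `[0,1]` with the points `a`. -/
abbrev cell (a : Fin (k + 1) → ℝ) (l : Fin k) : Set ℝ := Ioo (a l.castSucc) (a l.succ)

/-- The points `0 = a 0 < ... < a k = 1` divide `[0,1]` into cells on which `T` is expanding. -/
structure HasExpandingPartition (T : ℝ → ℝ) (lam M : ℝ) (k : ℕ) (a : Fin (k + 1) → ℝ) :
    Prop where
  strictMono : StrictMono a
  first : a 0 = 0
  last : a (Fin.last k) = 1
  expandingOn : ∀ l : Fin k, ExpandingOn T lam M (cell a l)

/-- Measurable maps of `[0,1]` with at most `N` branches, each with expansion `lam` and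
distortion `M`. -/
structure IsPiecewiseExpanding (T : ℝ → ℝ) (lam M : ℝ) (N : ℕ) : Prop where
  measurable : Measurable T
  mapsTo : MapsTo T (Icc 0 1) (Icc 0 1)
  exists_partition : ∃ (k : ℕ) (a : Fin (k + 1) → ℝ), k ≤ N ∧ HasExpandingPartition T lam M k a

theorem IsPiecewiseC2.isPiecewiseExpanding (h : IsPiecewiseC2 T k a) (hlam : 1 ≤ lam)
    (hk : k ≤ N)
    (hb : ∀ l : Fin k, ∀ x ∈ cell a l, lam ≤ |deriv T x| ∧ |deriv (deriv T) x| ≤ M) :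
    IsPiecewiseExpanding T lam M N :=
  ⟨h.measurable, h.mapsTo, k, a, hk, h.strictMono, h.first, h.last,
    fun l => h.expandingOn hlam l (hb l)⟩

theorem exists_mem_cell {x : ℝ} (h0 : a 0 < x) (h1 : x < a (Fin.last k)) (hx : ∀ l, x ≠ a l) :
    ∃ l : Fin k, x ∈ cell a l := by
  by_contra! H
  have hlt : ∀ l : Fin (k + 1), a l < x := by
    intro l
    induction l using Fin.induction with
    | zero => exact h0
    | succ l ih => exact (not_lt.1 fun hxl => H l ⟨ih, hxl⟩).lt_of_ne (hx _).symm
  exact lt_asymm h1 (hlt _)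

theorem le_castSucc_of_lt (ha : Monotone a) {l l' : Fin k} (hl : l < l') :
    a l.succ ≤ a l'.castSucc :=
  ha (Fin.succ_le_castSucc_iff.2 hl)

theorem volume_inter_preimage_eq_zero {J B : Set ℝ} (h : ExpandingOn T lam M J) (hlam : 1 ≤ lam)
    (hT : Measurable T) (hB : MeasurableSet B) (hnull : volume (T '' (J ∩ T ⁻¹' B)) = 0) :
    volume (J ∩ T ⁻¹' B) = 0 := by
  have hmeas : MeasurableSet (J ∩ T ⁻¹' B) := h.isOpen.measurableSet.inter (hT hB)
  have hinj : InjOn T (J ∩ T ⁻¹' B) := fun x hx y hy hxy => by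
    have hexp := h.mul_abs_sub_le hx.1 hy.1
    rw [hxy, sub_self, abs_zero] at hexp
    exact sub_eq_zero.1 (abs_nonpos_iff.1 (by nlinarith [abs_nonneg (x - y)]))
  refine le_antisymm ?_ zero_le
  calc volume (J ∩ T ⁻¹' B) = ∫⁻ _ in J ∩ T ⁻¹' B, 1 := (setLIntegral_one _).symm
    _ ≤ ∫⁻ x in J ∩ T ⁻¹' B, ENNReal.ofReal |deriv T x| := by
        refine setLIntegral_mono' hmeas fun x hx => ?_
        exact ENNReal.one_le_ofReal.2 (hlam.trans (h.le_abs_deriv x hx.1))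
    _ = volume (T '' (J ∩ T ⁻¹' B)) := by
        simpa using (lintegral_image_eq_lintegral_abs_deriv_mul hmeas (fun x hx =>
          (h.differentiableAt x hx.1).hasDerivAt.hasDerivWithinAt) hinj fun _ => 1).symm
    _ = 0 := hnull

namespace HasExpandingPartition

theorem ae_exists_mem_cell (h : HasExpandingPartition T lam M k a) :
    ∀ᵐ x ∂leb01, ∃ l : Fin k, x ∈ cell a l := by
  have hne : ∀ᵐ x ∂leb01, ∀ l, x ≠ a l :=
    ae_all_iff.2 fun l => ae_restrict_of_ae (Measure.ae_ne volume (a l))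
  filter_upwards [hne, ae_mem_Icc] with x hx hx01
  exact exists_mem_cell ((h.first ▸ hx01.1).lt_of_ne (hx 0).symm)
    ((h.last ▸ hx01.2).lt_of_ne (hx _)) hx

theorem cell_subset (h : HasExpandingPartition T lam M k a) (l : Fin k) :
    cell a l ⊆ Icc 0 1 := fun _ hx =>
  ⟨h.first ▸ (h.strictMono.monotone (Fin.zero_le _)).trans hx.1.le,
    h.last ▸ hx.2.le.trans (h.strictMono.monotone (Fin.le_last _))⟩

theorem disjoint_cell (h : HasExpandingPartition T lam M k a) {l l' : Fin k} (hl : l ≠ l') :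
    Disjoint (cell a l) (cell a l') := by
  wlog hlt : l < l' generalizing l l'
  · exact (this hl.symm (lt_of_le_of_ne (not_lt.1 hlt) hl.symm)).symm
  refine disjoint_left.2 fun x hx hx' => ?_
  exact lt_asymm hx.2 ((le_castSucc_of_lt h.strictMono.monotone hlt).trans_lt hx'.1)

end HasExpandingPartition

theorem IsPiecewiseExpanding.isNonsingular (h : IsPiecewiseExpanding T lam M N)
    (hlam : 1 ≤ lam) : IsNonsingular T := by
  refine ⟨⟨h.measurable, Measure.AbsolutelyContinuous.mk fun B hB h0 => ?_⟩, h.mapsTo⟩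
  obtain ⟨k, a, -, ha⟩ := h.exists_partition
  rw [leb01, Measure.restrict_apply hB] at h0
  have hcell : ∀ᵐ x ∂leb01, ∀ l : Fin k, x ∉ cell a l ∩ T ⁻¹' B := by
    refine ae_all_iff.2 fun l => ae_restrict_of_ae (measure_eq_zero_iff_ae_notMem.1 ?_)
    refine volume_inter_preimage_eq_zero (ha.expandingOn l) hlam h.measurable hB
      (measure_mono_null ?_ h0)
    rintro _ ⟨x, hx, rfl⟩
    exact ⟨hx.2, h.mapsTo (ha.cell_subset l hx.1)⟩
  rw [Measure.map_apply h.measurable hB, measure_eq_zero_iff_ae_notMem]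
  filter_upwards [hcell, ha.ae_exists_mem_cell] with x hx ⟨l, hl⟩ hxB using hx l ⟨hl, hxB⟩

theorem IsBranchPartition.comp {ι : Type*} {I : ι → Set ℝ} (h : IsBranchPartition S c I)
    (hP : HasExpandingPartition T lam M k a) (hS : IsNonsingular S)
    (hT : MapsTo T (Icc 0 1) (Icc 0 1)) (hlam : 1 ≤ lam) (hc0 : 0 ≤ c) (hc : c + M ≤ lam * c) :
    IsBranchPartition (T ∘ S) c fun p : ι × Fin k => I p.1 ∩ S ⁻¹' cell a p.2 where
  isBranch p := (h.isBranch p.1).comp (hP.expandingOn p.2) hT hlam hc0 hc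
  disjoint p q hpq := by
    by_cases h1 : p.1 = q.1
    · have h2 : p.2 ≠ q.2 := fun h2 => hpq (Prod.ext h1 h2)
      exact ((hP.disjoint_cell h2).preimage S).mono inter_subset_right inter_subset_right
    · exact (h.disjoint h1).mono inter_subset_left inter_subset_left
  cover := by
    filter_upwards [h.cover, hS.quasiMeasurePreserving.ae hP.ae_exists_mem_cell]
      with x ⟨b, hb⟩ ⟨l, hl⟩ using ⟨(b, l), hb, hl⟩

end Partition

/-! ### The sum of the branch weights -/

section Weight

variable {S T : ℝ → ℝ} {lam M c : ℝ} {k : ℕ} {a : Fin (k + 1) → ℝ} {I : Set ℝ}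

/-- The supremum of `1 / |S'|` on `I`, with value `0` if `I` is empty. -/
noncomputable def weight (S : ℝ → ℝ) (I : Set ℝ) : ℝ := sSup ((fun x => |deriv S x|⁻¹) '' I)

theorem weight_nonneg (S : ℝ → ℝ) (I : Set ℝ) : 0 ≤ weight S I := by
  refine Real.sSup_nonneg ?_
  rintro _ ⟨x, -, rfl⟩
  positivity

theorem weight_empty (S : ℝ → ℝ) : weight S ∅ = 0 := by simp [weight]

theorem weight_id (hI : I.Nonempty) : weight id I = 1 := by
  simp [weight, hI.image_const]

namespace IsBranch

theorem inv_abs_deriv_le_weight (h : IsBranch S c I) {x : ℝ} (hx : x ∈ I) :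
    |deriv S x|⁻¹ ≤ weight S I := by
  refine le_csSup ⟨1, ?_⟩ (mem_image_of_mem _ hx)
  rintro _ ⟨y, hy, rfl⟩
  exact inv_le_one_of_one_le₀ (h.one_le_abs_deriv y hy)

theorem weight_le_exp_mul (h : IsBranch S c I) (hc : 0 ≤ c) {y : ℝ} (hy : y ∈ I) :
    weight S I ≤ Real.exp c * |deriv S y|⁻¹ := by
  refine csSup_le (Set.Nonempty.image _ ⟨y, hy⟩) ?_
  rintro _ ⟨x, hx, rfl⟩
  exact h.inv_abs_deriv_le_exp_mul hc hx hy

theorem weight_comp_le {J : Set ℝ} (h : IsBranch S c I) (hJ : ExpandingOn T lam M J)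
    (hlam : 1 ≤ lam) : weight (T ∘ S) (I ∩ S ⁻¹' J) ≤ lam⁻¹ * weight S I := by
  refine Real.sSup_le ?_ (mul_nonneg (by positivity) (weight_nonneg _ _))
  rintro _ ⟨x, hx, rfl⟩
  simp only [h.abs_deriv_comp hJ hx, mul_inv]
  gcongr
  · exact hJ.le_abs_deriv _ hx.2
  · exact h.inv_abs_deriv_le_weight hx.1

theorem castSucc_mem_image (h : IsBranch S c I) (ha : Monotone a) {l l' : Fin k} (hl : l < l')
    (hne : (I ∩ S ⁻¹' cell a l).Nonempty) (hne' : (I ∩ S ⁻¹' cell a l').Nonempty) :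
    a l'.castSucc ∈ S '' I := by
  obtain ⟨x, hxI, hx⟩ := hne
  obtain ⟨y, hyI, hy⟩ := hne'
  exact h.ordConnected_image.out (mem_image_of_mem S hxI) (mem_image_of_mem S hyI)
    ⟨hx.2.le.trans (le_castSucc_of_lt ha hl), hy.1.le⟩

-- Every cell met by `S '' I`, except the leftmost one, has its left end point in `S '' I`.
theorem sum_weight_comp_le (h : IsBranch S c I) (hP : HasExpandingPartition T lam M k a)
    (hlam : 1 ≤ lam) (hc : 0 ≤ c) :
    ∑ l : Fin k, weight (T ∘ S) (I ∩ S ⁻¹' cell a l) ≤ lam⁻¹ * (weight S I +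
      ∑ l : Fin k, Real.exp c * branchDensity S (fun _ => 1) I (a l.castSucc)) := by
  classical
  let F : Finset (Fin k) := {l | (I ∩ S ⁻¹' cell a l).Nonempty ∧ a l.castSucc ∉ S '' I}
  have hF : F.card ≤ 1 := by
    refine Finset.card_le_one.2 fun l hl l' hl' => ?_
    simp only [F, Finset.mem_filter_univ] at hl hl'
    by_contra hne
    rcases lt_or_gt_of_ne hne with hlt | hlt
    · exact hl'.2 (h.castSucc_mem_image hP.strictMono.monotone hlt hl.1 hl'.1)
    · exact hl.2 (h.castSucc_mem_image hP.strictMono.monotone hlt hl'.1 hl.1)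
  have hcell : ∀ l : Fin k, weight (T ∘ S) (I ∩ S ⁻¹' cell a l) ≤ lam⁻¹ *
      ((if l ∈ F then weight S I else 0) +
        Real.exp c * branchDensity S (fun _ => 1) I (a l.castSucc)) := by
    intro l
    have hdens : 0 ≤ Real.exp c * branchDensity S (fun _ => 1) I (a l.castSucc) :=
      mul_nonneg (Real.exp_pos c).le (branchDensity_nonneg _ (fun _ => zero_le_one) _ _)
    have hW := weight_nonneg S I
    rcases eq_empty_or_nonempty (I ∩ S ⁻¹' cell a l) with hempty | hne
    · rw [hempty, weight_empty]
      positivity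
    refine (h.weight_comp_le (hP.expandingOn l) hlam).trans ?_
    gcongr
    by_cases hmem : a l.castSucc ∈ S '' I
    · obtain ⟨e, he, hea⟩ := hmem
      rw [← hea, h.branchDensity_apply _ he, mul_one]
      exact (h.weight_le_exp_mul hc he).trans (le_add_of_nonneg_left (by positivity))
    · rw [if_pos ((Finset.mem_filter_univ l).2 ⟨hne, hmem⟩)]
      exact le_add_of_nonneg_right hdens
  refine (Finset.sum_le_sum fun l _ => hcell l).trans ?_
  rw [← Finset.mul_sum, Finset.sum_add_distrib, Finset.sum_ite_mem, Finset.univ_inter,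
    Finset.sum_const, nsmul_eq_mul]
  gcongr
  exact mul_le_of_le_one_left (weight_nonneg _ _) (by exact_mod_cast hF)

end IsBranch

namespace IsBranchPartition

variable {ι : Type*} {I : ι → Set ℝ}

theorem exists_forall_mem_image_of_ae [Finite ι] (h : IsBranchPartition S c I) {p : ℝ → Prop}
    (hp : ∀ᵐ x ∂leb01, p x) {y : ℝ} (hy : ∃ b, y ∈ S '' I b) :
    ∃ x, p x ∧ ∀ b, y ∈ S '' I b → x ∈ S '' I b := by
  obtain ⟨b₀, hb₀⟩ := hy
  have hnhds : (⋂ b ∈ {b | y ∈ S '' I b}, S '' I b) ∈ nhds y := by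
    refine (Filter.biInter_mem (Set.toFinite _)).2 fun b hb => ?_
    obtain ⟨e, he, rfl⟩ := hb
    exact (h.isBranch b).image_mem_nhds he
  rw [leb01, ae_restrict_iff' measurableSet_Icc] at hp
  obtain ⟨x, hx, hpx⟩ := (frequently_ae_mem_iff.2
    (Measure.measure_pos_of_mem_nhds volume hnhds).ne').and_eventually hp |>.exists
  have hximage : ∀ b, y ∈ S '' I b → x ∈ S '' I b := fun b hb => mem_iInter₂.1 hx b hb
  exact ⟨x, hpx ((h.isBranch b₀).mapsTo.image_subset (hximage b₀ hb₀)), hximage⟩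

variable [Fintype ι]

theorem sum_branchDensity_one_le (h : IsBranchPartition S c I) (hc : 0 ≤ c)
    (hS : IsNonsingular S) {B : ℝ≥0} (hB : ∀ᵐ x ∂leb01, transferOp S (fun _ => 1) x ≤ B)
    (y : ℝ) : ∑ b, branchDensity S (fun _ => 1) (I b) y ≤ Real.exp c * B := by
  by_cases hy : ∃ b, y ∈ S '' I b
  swap
  · push Not at hy
    rw [Finset.sum_eq_zero fun b _ => branchDensity_of_notMem _ (hy b)]
    positivity
  obtain ⟨x, ⟨hformula, hxB⟩, hx⟩ := h.exists_forall_mem_image_of_ae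
    ((h.transferOp_ae_eq hS (integrable_const 1)).and hB) hy
  rw [hformula] at hxB
  refine le_trans ?_ (mul_le_mul_of_nonneg_left hxB (Real.exp_pos c).le)
  rw [Finset.mul_sum]
  refine Finset.sum_le_sum fun b _ => ?_
  by_cases hb : y ∈ S '' I b
  · obtain ⟨e', he', rfl⟩ := hx b hb
    obtain ⟨e, he, rfl⟩ := hb
    rw [(h.isBranch b).branchDensity_apply _ he, (h.isBranch b).branchDensity_apply _ he',
      mul_one, mul_one]
    exact (h.isBranch b).inv_abs_deriv_le_exp_mul hc he he'
  · rw [branchDensity_of_notMem _ hb]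
    exact mul_nonneg (Real.exp_pos c).le (branchDensity_nonneg _ (fun _ => zero_le_one) _ _)

theorem sum_weight_comp_le (h : IsBranchPartition S c I) (hP : HasExpandingPartition T lam M k a)
    (hlam : 1 ≤ lam) (hc : 0 ≤ c) {D : ℝ}
    (hD : ∀ y, ∑ b, branchDensity S (fun _ => 1) (I b) y ≤ D) :
    ∑ p : ι × Fin k, weight (T ∘ S) (I p.1 ∩ S ⁻¹' cell a p.2) ≤
      lam⁻¹ * (∑ b, weight S (I b) + k * (Real.exp c * D)) := by
  calc ∑ p : ι × Fin k, weight (T ∘ S) (I p.1 ∩ S ⁻¹' cell a p.2)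
      ≤ ∑ b, lam⁻¹ * (weight S (I b) + ∑ l : Fin k,
          Real.exp c * branchDensity S (fun _ => 1) (I b) (a l.castSucc)) := by
        rw [Fintype.sum_prod_type]
        exact Finset.sum_le_sum fun b _ => (h.isBranch b).sum_weight_comp_le hP hlam hc
    _ = lam⁻¹ * (∑ b, weight S (I b) + ∑ l : Fin k,
          Real.exp c * ∑ b, branchDensity S (fun _ => 1) (I b) (a l.castSucc)) := by
        simp only [← Finset.mul_sum, Finset.sum_add_distrib]
        rw [Finset.sum_comm]
    _ ≤ lam⁻¹ * (∑ b, weight S (I b) + ∑ _l : Fin k, Real.exp c * D) := by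
        gcongr
        exact hD _
    _ = lam⁻¹ * (∑ b, weight S (I b) + k * (Real.exp c * D)) := by simp

end IsBranchPartition

/-- The map `T_{j+1}` stretches the distance of `T_1^j x` and `T_1^j y` by the factor `lam` or
more, for each `j < i`: the orbits of `x` and `y` stay in the same branches up to time `i`. -/
def ExpandsUntil (T : ℕ → ℝ → ℝ) (lam : ℝ) (i : ℕ) (x y : ℝ) : Prop :=
  ∀ j < i, lam * |seqIter T j x - seqIter T j y| ≤ |seqIter T (j + 1) x - seqIter T (j + 1) y|

theorem ExpandsUntil.succ {T : ℕ → ℝ → ℝ} {i : ℕ} {x y : ℝ} (h : ExpandsUntil T lam i x y)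
    (hi : lam * |seqIter T i x - seqIter T i y| ≤
      |seqIter T (i + 1) x - seqIter T (i + 1) y|) : ExpandsUntil T lam (i + 1) x y := by
  intro j hj
  rcases Nat.lt_succ_iff_lt_or_eq.1 hj with hj | rfl
  · exact h j hj
  · exact hi

theorem exists_isBranchPartition_seqIter {T : ℕ → ℝ → ℝ} {N : ℕ} (hlam : 1 < lam) (hc : 0 ≤ c)
    (hcM : c + M ≤ lam * c) (hT : ∀ j, 1 ≤ j → IsPiecewiseExpanding (T j) lam M N) {B : ℝ≥0}
    (hB : ∀ i, ∀ᵐ x ∂leb01, transferOp (seqIter T i) (fun _ => 1) x ≤ B) (i : ℕ) :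
    ∃ (ι : Type) (_ : Fintype ι) (I : ι → Set ℝ), IsBranchPartition (seqIter T i) c I ∧
      (∀ b, ∀ x ∈ I b, ∀ y ∈ I b, ExpandsUntil T lam i x y) ∧
      ∑ b, weight (seqIter T i) (I b) ≤
        1 + N * (Real.exp c * (Real.exp c * B)) / (lam - 1) := by
  set Q := N * (Real.exp c * (Real.exp c * B)) with hQ
  have hlam' : 0 < lam - 1 := sub_pos.2 hlam
  induction i with
  | zero =>
    refine ⟨Unit, inferInstance, _, .id_Ioo hc, fun _ x _ y _ j hj => absurd hj j.not_lt_zero, ?_⟩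
    rw [Fintype.sum_unique, seqIter, weight_id (nonempty_Ioo.2 one_pos)]
    exact le_add_of_nonneg_right (by positivity)
  | succ i ih =>
    obtain ⟨ι, hι, I, hI, hexp, hsum⟩ := ih
    have hTi := hT (i + 1) i.succ_pos
    obtain ⟨k, a, hk, hP⟩ := hTi.exists_partition
    have hS : IsNonsingular (seqIter T i) :=
      .seqIter (fun j hj => (hT j hj).isNonsingular hlam.le) i
    refine ⟨ι × Fin k, inferInstance, _, hI.comp hP hS hTi.mapsTo hlam.le hc hcM,
      fun p x hx y hy => (hexp p.1 x hx.1 y hy.1).succ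
        ((hP.expandingOn p.2).mul_abs_sub_le hx.2 hy.2), ?_⟩
    have hstep := hI.sum_weight_comp_le hP hlam.le hc (hI.sum_branchDensity_one_le hc hS (hB i))
    calc ∑ p : ι × Fin k, weight (seqIter T (i + 1)) (I p.1 ∩ seqIter T i ⁻¹' cell a p.2)
        ≤ lam⁻¹ * (∑ b, weight (seqIter T i) (I b) + k * (Real.exp c * (Real.exp c * B))) := hstep
      _ ≤ lam⁻¹ * (1 + Q / (lam - 1) + Q) := by
          rw [hQ]
          gcongr
      _ ≤ 1 + Q / (lam - 1) := by
          rw [inv_mul_le_iff₀ (by positivity)]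
          have hfix : Q / (lam - 1) * (lam - 1) = Q := div_mul_cancel₀ _ hlam'.ne'
          nlinarith

end Weight

/-! ### Variation of the images under the transfer operator -/

section Variation

theorem eVariationOn_le_of_abs_sub_le {h φ : ℝ → ℝ} {v : ℝ}
    (hh : ∀ x ∈ Icc (0 : ℝ) 1, ∀ y ∈ Icc (0 : ℝ) 1, x ≤ y → |h y - h x| ≤ φ y - φ x)
    (hv : φ 1 - φ 0 ≤ v) : eVariationOn h (Icc 0 1) ≤ ENNReal.ofReal v := by
  have hmono : MonotoneOn φ (Icc 0 1) := fun x hx y hy hxy =>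
    sub_nonneg.1 ((abs_nonneg _).trans (hh x hx y hy hxy))
  have hle : eVariationOn h (Icc 0 1) ≤ eVariationOn φ (Icc 0 1) := by
    refine iSup_mono fun p => Finset.sum_le_sum fun j _ => ?_
    rw [edist_dist, edist_dist, Real.dist_eq, Real.dist_eq]
    exact ENNReal.ofReal_le_ofReal ((hh _ (p.2.2.2 j) _ (p.2.2.2 (j + 1))
      (p.2.2.1 (Nat.le_succ j))).trans (le_abs_self _))
  have hφ := hmono.eVariationOn_eq (a := 0) (b := 1) (by simp) (by simp)
  rw [inter_self] at hφ
  exact hle.trans (hφ.le.trans (ENNReal.ofReal_le_ofReal hv))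

/-- A monotone function whose increments dominate those of every function that vanishes off the
interval `Q` and is bounded by `s` and `q`-Lipschitz on `Q`: it jumps by `s` when entering and when
leaving `Q`, and grows linearly with slope `q`. -/
noncomputable def incrementBound (Q : Set ℝ) (s q x : ℝ) : ℝ :=
  (upperClosure Q : Set ℝ).indicator (fun _ => s) x +
    ((upperClosure Q : Set ℝ) \ Q).indicator (fun _ => s) x + q * x

theorem incrementBound_one_sub_zero_le (Q : Set ℝ) {s : ℝ} (hs : 0 ≤ s) (q : ℝ) :
    incrementBound Q s q 1 - incrementBound Q s q 0 ≤ 2 * s + q := by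
  classical
  simp only [incrementBound, indicator_apply]
  split_ifs <;> linarith

theorem abs_sub_le_incrementBound {h : ℝ → ℝ} {Q : Set ℝ} (hQ : Q.OrdConnected) {s q : ℝ}
    (hs0 : 0 ≤ s) (hq : 0 ≤ q) (h0 : ∀ x ∉ Q, h x = 0) (hs : ∀ x ∈ Q, |h x| ≤ s)
    (hL : ∀ x ∈ Q, ∀ y ∈ Q, |h x - h y| ≤ q * |x - y|) {x y : ℝ} (hxy : x ≤ y) :
    |h y - h x| ≤ incrementBound Q s q y - incrementBound Q s q x := by
  classical
  have hup : x ∈ upperClosure Q → y ∈ upperClosure Q := (upperClosure Q).upper hxy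
  have hQU : ∀ {z}, z ∈ Q → z ∈ upperClosure Q := fun hz => subset_upperClosure hz
  have hconv : x ∈ upperClosure Q → y ∈ Q → x ∈ Q := fun hx hy => by
    obtain ⟨z, hz, hzx⟩ := mem_upperClosure.1 hx
    exact hQ.out hz hy ⟨hzx, hxy⟩
  have hLip : x ∈ Q → y ∈ Q → |h y - h x| ≤ q * (y - x) := fun hx hy => by
    simpa only [abs_of_nonneg (sub_nonneg.2 hxy)] using hL y hy x hx
  have hqxy : 0 ≤ q * (y - x) := mul_nonneg hq (sub_nonneg.2 hxy)
  simp only [incrementBound, indicator_apply, mem_sdiff, SetLike.mem_coe]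
  by_cases hx : x ∈ Q <;> by_cases hy : y ∈ Q
  · simp only [hx, hy, hQU hx, hQU hy, if_true, not_true, and_false, if_false]
    linarith [hLip hx hy]
  · simp only [hx, hy, hQU hx, hup (hQU hx), h0 y hy, if_true, not_true, and_false, if_false,
      not_false_eq_true, and_self, zero_sub, abs_neg]
    linarith [hs x hx]
  · have hxU : x ∉ upperClosure Q := fun hxU => hx (hconv hxU hy)
    simp only [hy, hxU, hQU hy, h0 x hx, if_true, not_true, and_false, if_false, false_and,
      sub_zero]
    linarith [hs y hy]
  · rw [h0 x hx, h0 y hy, sub_zero, abs_zero]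
    split_ifs <;> first | linarith | simp_all

end Variation

section BranchVariation

variable {S w : ℝ → ℝ} {c s q W : ℝ} {I : Set ℝ}

theorem exp_mul_sub_one_le {c d : ℝ} (hc : 0 ≤ c) (hd0 : 0 ≤ d) (hd1 : d ≤ 1) :
    Real.exp (c * d) - 1 ≤ c * Real.exp c * d := by
  have hinv : 1 - c * d ≤ Real.exp (-(c * d)) := by linarith [Real.add_one_le_exp (-(c * d))]
  calc Real.exp (c * d) - 1 = Real.exp (c * d) * (1 - Real.exp (-(c * d))) := by
        rw [mul_sub, ← Real.exp_add, add_neg_cancel, Real.exp_zero, mul_one]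
    _ ≤ Real.exp c * (c * d) := by
        gcongr
        · exact sub_nonneg.2 (Real.exp_le_one_iff.2 (neg_nonpos.2 (mul_nonneg hc hd0)))
        · exact mul_le_of_le_one_right hc hd1
        · linarith
    _ = c * Real.exp c * d := by ring

namespace IsBranch

theorem abs_inv_sub_inv_le (h : IsBranch S c I) (hc : 0 ≤ c) {x y : ℝ} (hx : x ∈ I)
    (hy : y ∈ I) :
    |(|deriv S x|⁻¹ - |deriv S y|⁻¹)| ≤ weight S I * (c * Real.exp c) * |S x - S y| := by
  suffices key : ∀ x ∈ I, ∀ y ∈ I, |deriv S x|⁻¹ - |deriv S y|⁻¹ ≤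
      weight S I * (c * Real.exp c) * |S x - S y| by
    refine abs_sub_le_iff.2 ⟨key x hx y hy, ?_⟩
    rw [abs_sub_comm (S x)]
    exact key y hy x hx
  intro x hx y hy
  have hd := abs_sub_le_one (h.mapsTo hx) (h.mapsTo hy)
  calc |deriv S x|⁻¹ - |deriv S y|⁻¹
      ≤ |deriv S y|⁻¹ * (Real.exp (c * |S x - S y|) - 1) := by
        linarith [h.inv_abs_deriv_le_mul_exp_abs_sub hx hy]
    _ ≤ weight S I * (c * Real.exp c * |S x - S y|) := by
        gcongr
        · exact sub_nonneg.2 (Real.one_le_exp (by positivity))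
        · exact weight_nonneg S I
        · exact h.inv_abs_deriv_le_weight hy
        · exact exp_mul_sub_one_le hc (abs_nonneg _) hd
    _ = weight S I * (c * Real.exp c) * |S x - S y| := by ring

theorem abs_branchDensity_le (h : IsBranch S c I) (hs0 : 0 ≤ s) (hs : ∀ x ∈ I, |w x| ≤ s)
    (z : ℝ) : |branchDensity S w I z| ≤ weight S I * s := by
  have hW := weight_nonneg S I
  by_cases hz : z ∈ S '' I
  · obtain ⟨x, hx, rfl⟩ := hz
    rw [h.branchDensity_apply w hx, abs_mul, abs_inv, abs_abs]
    exact mul_le_mul (h.inv_abs_deriv_le_weight hx) (hs x hx) (abs_nonneg _) hW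
  · rw [branchDensity_of_notMem w hz, abs_zero]
    positivity

theorem abs_branchDensity_sub_le (h : IsBranch S c I) (hc : 0 ≤ c)
    (hs : ∀ x ∈ I, |w x| ≤ s) (hq : ∀ x ∈ I, ∀ y ∈ I, |w x - w y| ≤ q * |S x - S y|) :
    ∀ x ∈ S '' I, ∀ y ∈ S '' I, |branchDensity S w I x - branchDensity S w I y| ≤
      weight S I * (q + s * (c * Real.exp c)) * |x - y| := by
  rintro _ ⟨x, hx, rfl⟩ _ ⟨y, hy, rfl⟩
  rw [h.branchDensity_apply w hx, h.branchDensity_apply w hy]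
  have hderiv := h.abs_inv_sub_inv_le hc hx hy
  calc |(|deriv S x|⁻¹ * w x - |deriv S y|⁻¹ * w y)|
      = |(|deriv S x|⁻¹ * (w x - w y) + (|deriv S x|⁻¹ - |deriv S y|⁻¹) * w y)| := by
        congr 1
        ring
    _ ≤ |deriv S x|⁻¹ * |w x - w y| + |(|deriv S x|⁻¹ - |deriv S y|⁻¹)| * |w y| := by
        refine (abs_add_le _ _).trans_eq ?_
        rw [abs_mul, abs_mul, abs_inv, abs_abs]
    _ ≤ weight S I * (q * |S x - S y|) + weight S I * (c * Real.exp c) * |S x - S y| * s :=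
        add_le_add
          (mul_le_mul (h.inv_abs_deriv_le_weight hx) (hq x hx y hy) (abs_nonneg _)
            (weight_nonneg S I))
          (mul_le_mul hderiv (hs y hy) (abs_nonneg _) ((abs_nonneg _).trans hderiv))
    _ = weight S I * (q + s * (c * Real.exp c)) * |S x - S y| := by ring

end IsBranch

namespace IsBranchPartition

variable {ι : Type*} [Fintype ι] {I : ι → Set ℝ}

theorem essVar_transferOp_le (h : IsBranchPartition S c I) (hc : 0 ≤ c) (hS : IsNonsingular S)
    (hw : Integrable w leb01) (hs0 : 0 ≤ s) (hq0 : 0 ≤ q) (hs : ∀ b, ∀ x ∈ I b, |w x| ≤ s)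
    (hq : ∀ b, ∀ x ∈ I b, ∀ y ∈ I b, |w x - w y| ≤ q * |S x - S y|)
    (hW : ∑ b, weight S (I b) ≤ W) :
    essVar (transferOp S w) ≤ ENNReal.ofReal (W * (2 * s + (q + s * (c * Real.exp c)))) := by
  set L := q + s * (c * Real.exp c)
  have hL : 0 ≤ L := by positivity
  have hwt := fun b => weight_nonneg S (I b)
  refine (essVar_le (h.transferOp_ae_eq hS hw).symm).trans (eVariationOn_le_of_abs_sub_le
    (φ := fun x => ∑ b, incrementBound (S '' I b) (weight S (I b) * s) (weight S (I b) * L) x)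
    (fun x _ y _ hxy => ?_) ?_)
  · rw [← Finset.sum_sub_distrib, ← Finset.sum_sub_distrib]
    refine (Finset.abs_sum_le_sum_abs _ _).trans (Finset.sum_le_sum fun b _ => ?_)
    have hb := h.isBranch b
    exact abs_sub_le_incrementBound hb.ordConnected_image (mul_nonneg (hwt b) hs0)
      (mul_nonneg (hwt b) hL) (fun x hx => branchDensity_of_notMem w hx)
      (fun x _ => hb.abs_branchDensity_le hs0 (hs b) x)
      (hb.abs_branchDensity_sub_le hc (hs b) (hq b)) hxy
  · rw [← Finset.sum_sub_distrib]
    calc ∑ b, (incrementBound (S '' I b) (weight S (I b) * s) (weight S (I b) * L) 1 -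
          incrementBound (S '' I b) (weight S (I b) * s) (weight S (I b) * L) 0)
        ≤ ∑ b, (2 * (weight S (I b) * s) + weight S (I b) * L) := Finset.sum_le_sum fun b _ =>
          incrementBound_one_sub_zero_le _ (mul_nonneg (hwt b) hs0) _
      _ = (∑ b, weight S (I b)) * (2 * s + L) := by
          rw [Finset.sum_mul]
          exact Finset.sum_congr rfl fun b _ => by ring
      _ ≤ W * (2 * s + L) := by gcongr

theorem eLpNorm_transferOp_le (h : IsBranchPartition S c I) (hS : IsNonsingular S)
    (hw : Integrable w leb01) (hs0 : 0 ≤ s) (hs : ∀ b, ∀ x ∈ I b, |w x| ≤ s)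
    (hW : ∑ b, weight S (I b) ≤ W) :
    eLpNorm (transferOp S w) 1 leb01 ≤ ENNReal.ofReal (W * s) := by
  have hbound : ∀ᵐ x ∂leb01, ‖transferOp S w x‖ ≤ W * s := by
    filter_upwards [h.transferOp_ae_eq hS hw] with x hx
    rw [hx, Real.norm_eq_abs]
    calc |∑ b, branchDensity S w (I b) x|
        ≤ ∑ b, |branchDensity S w (I b) x| := Finset.abs_sum_le_sum_abs _ _
      _ ≤ ∑ b, weight S (I b) * s := Finset.sum_le_sum fun b _ =>
          (h.isBranch b).abs_branchDensity_le hs0 (hs b) x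
      _ = (∑ b, weight S (I b)) * s := by rw [Finset.sum_mul]
      _ ≤ W * s := by gcongr
  simpa using eLpNorm_le_of_ae_bound (p := 1) hbound

theorem bvNorm_transferOp_le (h : IsBranchPartition S c I) (hc : 0 ≤ c) (hS : IsNonsingular S)
    (hw : Integrable w leb01) (hs0 : 0 ≤ s) (hq0 : 0 ≤ q) (hs : ∀ b, ∀ x ∈ I b, |w x| ≤ s)
    (hq : ∀ b, ∀ x ∈ I b, ∀ y ∈ I b, |w x - w y| ≤ q * |S x - S y|)
    (hW : ∑ b, weight S (I b) ≤ W) :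
    bvNorm (transferOp S w) ≤ ENNReal.ofReal (W * (3 * s + q + s * (c * Real.exp c))) := by
  have hW0 : 0 ≤ W := (Finset.sum_nonneg fun b _ => weight_nonneg S (I b)).trans hW
  refine (add_le_add (h.essVar_transferOp_le hc hS hw hs0 hq0 hs hq hW)
    (h.eLpNorm_transferOp_le hS hw hs0 hs hW)).trans_eq ?_
  rw [← ENNReal.ofReal_add (by positivity) (by positivity)]
  congr 1
  ring

end IsBranchPartition

end BranchVariation

/-! ### Densities of the compositions -/

section Density

variable {f : ℝ → ℝ} {C : Set (ℝ → ℝ)} {T : ℕ → ℝ → ℝ}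

theorem bvNorm_one_le : bvNorm (fun _ => 1) ≤ 1 := by
  have hvar : essVar (fun _ => 1) ≤ 0 :=
    (essVar_le (Filter.EventuallyEq.refl _ _)).trans (by simp [eVariationOn])
  have hnorm : eLpNorm (fun _ : ℝ => (1 : ℝ)) 1 leb01 = 1 := by
    simp [eLpNorm_one_eq_lintegral_enorm]
  calc bvNorm (fun _ => 1) ≤ 0 + 1 := add_le_add hvar hnorm.le
    _ = 1 := zero_add 1

theorem bvNorm_sub_one_le (hf : Integrable f leb01) :
    bvNorm (fun x => f x - 1) ≤ bvNorm f + 1 := calc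
  bvNorm (fun x => f x - 1) ≤ essVar f + (eLpNorm f 1 leb01 + 1) := by
    refine add_le_add (essVar_sub_const_le f 1)
      ((eLpNorm_sub_le hf.1 (integrable_const (1 : ℝ)).1 le_rfl).trans ?_)
    gcongr
    exact le_add_self.trans bvNorm_one_le
  _ = bvNorm f + 1 := by rw [bvNorm, add_assoc]

theorem isBV_of_bvNorm_lt_top (hf : Integrable f leb01) (h : bvNorm f < ∞) : IsBV f :=
  ⟨hf, le_self_add.trans_lt h⟩

theorem transferOp_id_ae_eq (hf : Integrable f leb01) : transferOp id f =ᵐ[leb01] f :=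
  transferOp_ae_eq .id hf hf fun _ _ => rfl

theorem IsPiecewiseExpanding.bvNorm_transferOp_one_le {S : ℝ → ℝ} {lam M c : ℝ} {N : ℕ}
    (h : IsPiecewiseExpanding S lam M N) (hlam : 1 ≤ lam) (hc : 0 ≤ c)
    (hcM : c + M ≤ lam * c) :
    bvNorm (transferOp S fun _ => 1) ≤ ENNReal.ofReal
      (lam⁻¹ * (1 + N * (Real.exp c * Real.exp c)) * (3 + c * Real.exp c)) := by
  obtain ⟨k, a, hk, hP⟩ := h.exists_partition
  have hid := IsBranchPartition.id_Ioo hc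
  have hone : ∀ᵐ x ∂leb01, transferOp id (fun _ => 1) x ≤ (1 : ℝ≥0) := by
    filter_upwards [transferOp_id_ae_eq (integrable_const (1 : ℝ))] with x hx
    simp [hx]
  have hweight := hid.sum_weight_comp_le hP hlam hc (hid.sum_branchDensity_one_le hc .id hone)
  have hW := hweight.trans (b := _) (c := lam⁻¹ * (1 + N * (Real.exp c * Real.exp c))) (by
    rw [Fintype.sum_unique, weight_id (nonempty_Ioo.2 one_pos), NNReal.coe_one, mul_one]
    gcongr)
  refine ((hid.comp hP .id h.mapsTo hlam hc hcM).bvNorm_transferOp_le hc (h.isNonsingular hlam)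
    (integrable_const (1 : ℝ)) (s := 1) (q := 0) zero_le_one le_rfl (by simp) (by simp)
    hW).trans_eq ?_
  simp

theorem ConditionDec.exists_forall_bvNorm_le (h : ConditionDec C) :
    ∃ θ K : ℝ≥0, θ < 1 ∧ ∀ l, ∀ T : ℕ → ℝ → ℝ, (∀ j, 1 ≤ j → T j ∈ C) →
      ∀ f, IsBV f → ∫ x, f x ∂leb01 = 0 → bvNorm (transferSeq T l f) ≤ K * θ ^ l * bvNorm f := by
  obtain ⟨θ, K, hθ, -, hK⟩ := h
  refine ⟨θ, K + 1, hθ, fun l T hT f hf hf0 => ?_⟩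
  rcases l.eq_zero_or_pos with rfl | hl
  · rw [pow_zero, mul_one]
    exact le_mul_of_one_le_left zero_le (by simp)
  · refine (hK l hl T hT f hf hf0).trans ?_
    gcongr
    simp

theorem transferSeq_succ_one_ae_le (hT : ∀ j, 1 ≤ j → IsNonsingular (T j)) {n : ℕ} {b : ℝ}
    (hb : 0 ≤ b) (h : bvNorm (transferSeq (fun j => T (j + 1)) n
      fun x => transferOp (T 1) (fun _ => 1) x - 1) ≤ ENNReal.ofReal b) :
    ∀ᵐ x ∂leb01, transferSeq T (n + 1) (fun _ => 1) x ≤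
      transferSeq (fun j => T (j + 1)) n (fun _ => 1) x + b := by
  set T' : ℕ → ℝ → ℝ := fun j => T (j + 1)
  set f := transferOp (T 1) fun _ => 1
  have hT' : ∀ j, 1 ≤ j → IsNonsingular (T' j) := fun j _ => hT (j + 1) j.succ_pos
  have hf : Integrable f leb01 := integrable_transferOp _ _
  have hone : Integrable (fun _ : ℝ => (1 : ℝ)) leb01 := integrable_const _
  have hfirst : transferSeq T (n + 1) (fun _ => 1) = transferSeq T' n f := by
    rw [add_comm n 1, transferSeq_add]
    rfl
  filter_upwards [ae_abs_le_of_bvNorm_le hb h, transferOp_seqIter_ae_eq hT' (hf.sub hone) n,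
    transferOp_sub_ae_eq (.seqIter hT' n) hf hone, transferOp_seqIter_ae_eq hT' hf n,
    transferOp_seqIter_ae_eq hT' hone n] with x hx hsub hlin hxf hx1
  have hdiff : transferSeq T' n (f - fun _ => 1) x ≤ b := (le_abs_self _).trans hx
  rw [hfirst]
  simp only [Pi.sub_apply] at hlin
  linarith

theorem sum_range_pow_le {θ : ℝ} (h0 : 0 ≤ θ) (h1 : θ < 1) (n : ℕ) :
    ∑ l ∈ Finset.range n, θ ^ l ≤ (1 - θ)⁻¹ := by
  rw [← tsum_geometric_of_lt_one h0 h1]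
  exact (summable_geometric_of_lt_one h0 h1).sum_le_tsum _ fun _ _ => pow_nonneg h0 _

theorem transferSeq_one_ae_le_sum (hC : ∀ S ∈ C, IsNonsingular S) {b : ℕ → ℝ} (hb : ∀ n, 0 ≤ b n)
    (h : ∀ n, ∀ T : ℕ → ℝ → ℝ, (∀ j, 1 ≤ j → T j ∈ C) →
      bvNorm (transferSeq (fun j => T (j + 1)) n fun x => transferOp (T 1) (fun _ => 1) x - 1) ≤
        ENNReal.ofReal (b n)) (n : ℕ) (hT : ∀ j, 1 ≤ j → T j ∈ C) :
    ∀ᵐ x ∂leb01, transferSeq T n (fun _ => 1) x ≤ 1 + ∑ l ∈ Finset.range n, b l := by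
  induction n generalizing T with
  | zero => simp [transferSeq]
  | succ n ih =>
    filter_upwards [ih fun j _ => hT (j + 1) j.succ_pos, transferSeq_succ_one_ae_le
      (fun j hj => hC _ (hT j hj)) (hb n) (h n T hT)] with x hx hx'
    rw [Finset.sum_range_succ]
    linarith

theorem integral_transferOp_one_sub_one {S : ℝ → ℝ} (hS : IsNonsingular S) :
    ∫ x, (transferOp S (fun _ => 1) x - 1) ∂leb01 = 0 := by
  rw [integral_sub (integrable_transferOp S _) (integrable_const 1),
    integral_transferOp hS (integrable_const 1), sub_self]

theorem ConditionDec.exists_transferSeq_one_ae_le (h : ConditionDec C)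
    (hC : ∀ S ∈ C, IsNonsingular S) {b : ℝ≥0}
    (hb : ∀ S ∈ C, bvNorm (transferOp S fun _ => 1) ≤ b) :
    ∃ B : ℝ≥0, ∀ T : ℕ → ℝ → ℝ, (∀ j, 1 ≤ j → T j ∈ C) → ∀ n,
      ∀ᵐ x ∂leb01, transferSeq T n (fun _ => 1) x ≤ B := by
  obtain ⟨θ, K, hθ, hK⟩ := h.exists_forall_bvNorm_le
  have hdecay : ∀ n, ∀ T : ℕ → ℝ → ℝ, (∀ j, 1 ≤ j → T j ∈ C) →
      bvNorm (transferSeq (fun j => T (j + 1)) n fun x => transferOp (T 1) (fun _ => 1) x - 1) ≤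
        ENNReal.ofReal (K * (b + 1) * θ ^ n : ℝ≥0) := by
    intro n T hT
    have hint := integrable_transferOp (T 1) fun _ => 1
    have hnorm := (bvNorm_sub_one_le hint).trans (add_le_add_left (hb _ (hT 1 le_rfl)) 1)
    refine (hK n _ (fun j _ => hT (j + 1) j.succ_pos) _ (isBV_of_bvNorm_lt_top
      (hint.sub (integrable_const 1)) (hnorm.trans_lt (by simp)))
      (integral_transferOp_one_sub_one (hC _ (hT 1 le_rfl)))).trans ?_
    rw [ENNReal.ofReal_coe_nnreal, mul_right_comm]
    push_cast
    gcongr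
    exact hnorm
  refine ⟨1 + K * (b + 1) * (1 - θ)⁻¹, fun T hT n => ?_⟩
  filter_upwards [transferSeq_one_ae_le_sum hC (fun _ => NNReal.coe_nonneg _) hdecay n hT] with x hx
  refine hx.trans ?_
  push_cast [NNReal.coe_sub hθ.le]
  rw [← Finset.mul_sum]
  gcongr
  exact sum_range_pow_le θ.coe_nonneg (by exact_mod_cast hθ) n

end Density

/-! ### Decay of correlations -/

section Decay

variable {C : Set (ℝ → ℝ)} {T : ℕ → ℝ → ℝ} {S w : ℝ → ℝ} {lam M s q δ : ℝ} {N i : ℕ}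

/-- Observables of the orbit up to time `i`: `w` is bounded by `s` on `[0,1]` and is a
`q`-Lipschitz function of the position at time `i` along the pairs of points that separate at rate
`lam` up to that time. Only such pairs can be compared, because `w` may jump between branches. -/
structure LipschitzAlong (T : ℕ → ℝ → ℝ) (lam : ℝ) (i : ℕ) (s q : ℝ) (w : ℝ → ℝ) : Prop where
  bound : ∀ x ∈ Icc (0 : ℝ) 1, |w x| ≤ s
  lipschitz : ∀ x ∈ Icc (0 : ℝ) 1, ∀ y ∈ Icc (0 : ℝ) 1, ExpandsUntil T lam i x y →
    |w x - w y| ≤ q * |seqIter T i x - seqIter T i y|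

/-- Exponential decay, with rate `θ`, of the correlations between `T_1^(i+l)` and the observables
of the orbit up to time `i`, relative to the measure of the events that depend on `T_1^(i+l)`. -/
structure HasDecay (T : ℕ → ℝ → ℝ) (lam E θ : ℝ) : Prop where
  isNonsingular : ∀ j, 1 ≤ j → IsNonsingular (T j)
  one_lt : 1 < lam
  E_nonneg : 0 ≤ E
  θ_nonneg : 0 ≤ θ
  θ_lt_one : θ < 1
  decay : ∀ i l, 1 ≤ l → ∀ w s q, Integrable w leb01 → ∫ x, w x ∂leb01 = 0 → 0 ≤ q →
    LipschitzAlong T lam i s q w → ∀ B, MeasurableSet B →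
      |∫ x in seqIter T (i + l) ⁻¹' B, w x ∂leb01| ≤
        E * θ ^ l * (s + q) * leb01.real (seqIter T (i + l) ⁻¹' B)

theorem mul_measureReal_le_measureReal_preimage (hS : IsNonsingular S)
    (hδ : ∀ᵐ x ∂leb01, δ ≤ transferOp S (fun _ => 1) x) {B : Set ℝ} (hB : MeasurableSet B) :
    δ * leb01.real B ≤ leb01.real (S ⁻¹' B) := calc
  δ * leb01.real B = ∫ _ in B, δ ∂leb01 := by rw [setIntegral_const, smul_eq_mul, mul_comm]
  _ ≤ ∫ x in B, transferOp S (fun _ => 1) x ∂leb01 :=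
    setIntegral_mono_ae (integrable_const _).integrableOn
      (integrable_transferOp _ _).integrableOn hδ
  _ = leb01.real (S ⁻¹' B) := by
    rw [setIntegral_transferOp hS (integrable_const 1) hB, setIntegral_const, smul_eq_mul, mul_one]

theorem abs_setIntegral_preimage_le (hS : IsNonsingular S) (hδ0 : 0 < δ)
    (hδ : ∀ᵐ x ∂leb01, δ ≤ transferOp S (fun _ => 1) x) (hw : Integrable w leb01) {b : ℝ}
    (hb0 : 0 ≤ b) (hb : ∀ᵐ x ∂leb01, |transferOp S w x| ≤ b) {B : Set ℝ} (hB : MeasurableSet B) :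
    |∫ x in S ⁻¹' B, w x ∂leb01| ≤ b / δ * leb01.real (S ⁻¹' B) := calc
  |∫ x in S ⁻¹' B, w x ∂leb01| = ‖∫ x in B, transferOp S w x ∂leb01‖ := by
    rw [setIntegral_transferOp hS hw hB, Real.norm_eq_abs]
  _ ≤ b * leb01.real B :=
    norm_setIntegral_le_of_norm_le_const_ae (measure_lt_top _ _) (ae_restrict_of_ae hb)
  _ = b / δ * (δ * leb01.real B) := by field_simp
  _ ≤ b / δ * leb01.real (S ⁻¹' B) := by
    gcongr
    exact mul_measureReal_le_measureReal_preimage hS hδ hB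

theorem IsBranchPartition.bvNorm_transferOp_le_of_lipschitzAlong {ι : Type*} [Fintype ι]
    {I : ι → Set ℝ} {c W : ℝ} (h : IsBranchPartition (seqIter T i) c I) (hc : 0 ≤ c)
    (hT : IsNonsingular (seqIter T i))
    (hexp : ∀ b, ∀ x ∈ I b, ∀ y ∈ I b, ExpandsUntil T lam i x y)
    (hW : ∑ b, weight (seqIter T i) (I b) ≤ W) (hw : Integrable w leb01) (hq : 0 ≤ q)
    (hlip : LipschitzAlong T lam i s q w) :
    bvNorm (transferOp (seqIter T i) w) ≤
      ENNReal.ofReal (W * (3 + c * Real.exp c) * (s + q)) := by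
  have hs : 0 ≤ s := (abs_nonneg _).trans (hlip.bound 0 (by simp))
  have hI := fun b => (h.isBranch b).subset
  have hW0 : 0 ≤ W := (Finset.sum_nonneg fun b _ => weight_nonneg _ (I b)).trans hW
  refine (h.bvNorm_transferOp_le hc hT hw hs hq (fun b x hx => hlip.bound x (hI b hx))
    (fun b x hx y hy => hlip.lipschitz x (hI b hx) y (hI b hy) (hexp b x hx y hy)) hW).trans
    (ENNReal.ofReal_le_ofReal ?_)
  rw [mul_assoc]
  gcongr
  have hce : 0 ≤ c * Real.exp c * q := by positivity
  linarith

theorem exists_bvNorm_transferSeq_le (hlam : 1 < lam) (hM : 0 ≤ M)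
    (hC : ∀ S ∈ C, IsPiecewiseExpanding S lam M N) (hdec : ConditionDec C) :
    ∃ R : ℝ, 0 ≤ R ∧ ∀ T : ℕ → ℝ → ℝ, (∀ j, 1 ≤ j → T j ∈ C) → ∀ i w s q,
      Integrable w leb01 → 0 ≤ q → LipschitzAlong T lam i s q w →
      bvNorm (transferSeq T i w) ≤ ENNReal.ofReal (R * (s + q)) := by
  set c := M / (lam - 1)
  have hlam' : 0 < lam - 1 := sub_pos.2 hlam
  have hc : 0 ≤ c := by positivity
  have hcM : c + M ≤ lam * c := by
    have hmul : c * (lam - 1) = M := div_mul_cancel₀ _ hlam'.ne'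
    linarith
  have hns : ∀ S ∈ C, IsNonsingular S := fun S hS => (hC S hS).isNonsingular hlam.le
  obtain ⟨B, hB⟩ := hdec.exists_transferSeq_one_ae_le hns
    fun S hS => (hC S hS).bvNorm_transferOp_one_le hlam.le hc hcM
  refine ⟨(1 + N * (Real.exp c * (Real.exp c * B)) / (lam - 1)) * (3 + c * Real.exp c),
    by positivity, fun T hT i w s q hw hq hlip => ?_⟩
  have hTns : ∀ j, 1 ≤ j → IsNonsingular (T j) := fun j hj => hns _ (hT j hj)
  have hB' : ∀ i, ∀ᵐ x ∂leb01, transferOp (seqIter T i) (fun _ => 1) x ≤ B := fun i => by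
    filter_upwards [transferOp_seqIter_ae_eq hTns (integrable_const 1) i, hB T hT i] with x hx hxB
    rwa [hx]
  obtain ⟨ι, _, I, hI, hexp, hsum⟩ :=
    exists_isBranchPartition_seqIter hlam hc hcM (fun j hj => hC _ (hT j hj)) hB' i
  rw [← bvNorm_congr (transferOp_seqIter_ae_eq hTns hw i)]
  exact hI.bvNorm_transferOp_le_of_lipschitzAlong hc (.seqIter hTns i) hexp hsum hw hq hlip

theorem exists_hasDecay (hlam : 1 < lam) (hM : 0 ≤ M)
    (hC : ∀ S ∈ C, IsPiecewiseExpanding S lam M N) (hdec : ConditionDec C)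
    (hT : ∀ n, 1 ≤ n → T n ∈ C) (hmin : ConditionMin T) : ∃ E θ, HasDecay T lam E θ := by
  have hns : ∀ j, 1 ≤ j → IsNonsingular (T j) := fun j hj =>
    (hC _ (hT j hj)).isNonsingular hlam.le
  obtain ⟨R, hR0, hR⟩ := exists_bvNorm_transferSeq_le hlam hM hC hdec
  obtain ⟨θ, K, hθ, hK⟩ := hdec.exists_forall_bvNorm_le
  obtain ⟨δ, hδ, hmin⟩ := hmin
  refine ⟨K * R / δ, θ, hns, hlam, by positivity, θ.coe_nonneg, by exact_mod_cast hθ,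
    fun i l hl w s q hw hw0 hq hlip B hB => ?_⟩
  have hsq : 0 ≤ s + q := add_nonneg ((abs_nonneg _).trans (hlip.bound 0 (by simp))) hq
  have hbv := hR T hT i w s q hw hq hlip
  have hmean : ∫ x, transferSeq T i w x ∂leb01 = 0 := by
    rw [← integral_congr_ae (transferOp_seqIter_ae_eq hns hw i),
      integral_transferOp (.seqIter hns i) hw, hw0]
  have hnorm : bvNorm (transferSeq T (i + l) w) ≤
      ENNReal.ofReal (K * θ ^ l * (R * (s + q))) := by
    rw [transferSeq_add, ENNReal.ofReal_mul (by positivity), ENNReal.ofReal_mul (by positivity),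
      ENNReal.ofReal_coe_nnreal, ENNReal.ofReal_pow θ.coe_nonneg, ENNReal.ofReal_coe_nnreal]
    refine (hK l _ (fun j hj => hT _ (hj.trans (Nat.le_add_right j i))) _ (isBV_of_bvNorm_lt_top
      (integrable_transferSeq T hw i) (hbv.trans_lt ENNReal.ofReal_lt_top)) hmean).trans ?_
    gcongr
  rw [← bvNorm_congr (transferOp_seqIter_ae_eq hns hw (i + l))] at hnorm
  refine (abs_setIntegral_preimage_le (.seqIter hns (i + l)) hδ (hmin _ (by omega)) hw
    (by positivity) (ae_abs_le_of_bvNorm_le (by positivity) hnorm) hB).trans_eq ?_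
  ring

end Decay

/-! ### Functions of the orbit -/

section Orbit

variable {T : ℕ → ℝ → ℝ} {lam E θ : ℝ} {n : ℕ} {F : (ℕ → ℝ) → ℝ} {z : ℕ → ℝ}

/-- `F` is `1`-Lipschitz for the mean distance of the first `n` coordinates, as is the distance to
a set of orbits up to time `n`. -/
def IsMeanLipschitz (n : ℕ) (F : (ℕ → ℝ) → ℝ) : Prop :=
  ∀ u v : ℕ → ℝ, |F u - F v| ≤ 1 / n * ∑ k ∈ Finset.range n, |u k - v k|

/-- The sequence that agrees with the orbit of `x` before time `i` and with `z` from then on: the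
past of `x`, glued to the future `z`. -/
def mixOrbit (T : ℕ → ℝ → ℝ) (i : ℕ) (z : ℕ → ℝ) (x : ℝ) : ℕ → ℝ :=
  fun k => if k < i then seqIter T k x else z k

/-- The continuation of an orbit that is at `u` at time `p`. Only its coordinates `k ≥ p` are
meaningful, the others are `u`. -/
def tailOrbit (T : ℕ → ℝ → ℝ) (p : ℕ) (u : ℝ) : ℕ → ℝ :=
  fun k => seqIter (fun j => T (j + p)) (k - p) u

/-- The mean of `F` over the past up to time `p`, for the future that starts at `u` at time `p`. -/
noncomputable def tailMean (T : ℕ → ℝ → ℝ) (F : (ℕ → ℝ) → ℝ) (p : ℕ) (u : ℝ) : ℝ :=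
  ∫ y, F (mixOrbit T p (tailOrbit T p u) y) ∂leb01

theorem abs_integral_le_of_ae_abs_le {Ω : Type*} [MeasurableSpace Ω] {μ : Measure Ω}
    [IsProbabilityMeasure μ] {f : Ω → ℝ} {b : ℝ} (hf : ∀ᵐ x ∂μ, |f x| ≤ b) :
    |∫ x, f x ∂μ| ≤ b := by
  simpa using norm_integral_le_of_norm_le_const (μ := μ) (f := f) hf

theorem seqIter_seqIter (T : ℕ → ℝ → ℝ) (p l : ℕ) (x : ℝ) :
    seqIter (fun j => T (j + p)) l (seqIter T p x) = seqIter T (p + l) x := by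
  induction l with
  | zero => rfl
  | succ l ih => rw [seqIter, Function.comp_apply, ih, add_right_comm l 1 p, add_comm l p]; rfl

theorem tailOrbit_seqIter (T : ℕ → ℝ → ℝ) {p k : ℕ} (hk : p ≤ k) (x : ℝ) :
    tailOrbit T p (seqIter T p x) k = seqIter T k x := by
  rw [tailOrbit, seqIter_seqIter, Nat.add_sub_cancel' hk]

theorem mixOrbit_zero (T : ℕ → ℝ → ℝ) (z : ℕ → ℝ) (x : ℝ) : mixOrbit T 0 z x = z := rfl

theorem mixOrbit_tailOrbit (T : ℕ → ℝ → ℝ) (p : ℕ) (x : ℝ) :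
    mixOrbit T p (tailOrbit T p (seqIter T p x)) x = fun k => seqIter T k x := by
  funext k
  by_cases hk : k < p
  · exact if_pos hk
  · exact (if_neg hk).trans (tailOrbit_seqIter T (not_lt.1 hk) x)

namespace IsMeanLipschitz

theorem continuous (hF : IsMeanLipschitz n F) : Continuous F := by
  refine continuous_iff_continuousAt.2 fun v => tendsto_iff_dist_tendsto_zero.2 ?_
  have hbound : Continuous fun u : ℕ → ℝ => 1 / (n : ℝ) * ∑ k ∈ Finset.range n, |u k - v k| := by
    fun_prop
  exact squeeze_zero (fun _ => dist_nonneg) (fun u => hF u v) (by simpa using hbound.tendsto v)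

theorem abs_sub_le (hF : IsMeanLipschitz n F) {u v : ℕ → ℝ} {d : ℝ} (hd : 0 ≤ d)
    (h : ∀ k < n, |u k - v k| ≤ d) : |F u - F v| ≤ d := calc
  |F u - F v| ≤ 1 / n * ∑ k ∈ Finset.range n, |u k - v k| := hF u v
  _ ≤ 1 / n * ∑ _k ∈ Finset.range n, d := by
    gcongr with k hk
    exact h k (Finset.mem_range.1 hk)
  _ = n / n * d := by
    rw [Finset.sum_const, Finset.card_range, nsmul_eq_mul]
    ring
  _ ≤ d := mul_le_of_le_one_left hd (div_self_le_one _)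

theorem abs_sub_le_of_eq_of_ne (hF : IsMeanLipschitz n F) {u v : ℕ → ℝ} {i : ℕ}
    (h : ∀ k ≠ i, u k = v k) (hi : |u i - v i| ≤ 1) : |F u - F v| ≤ 1 / n := by
  refine (hF u v).trans (mul_le_of_le_one_right (by positivity) ?_)
  calc ∑ k ∈ Finset.range n, |u k - v k| ≤ ∑ k ∈ Finset.range n, if k = i then 1 else 0 := by
        gcongr with k
        split_ifs with hk
        · rwa [hk]
        · rw [h k hk, sub_self, abs_zero]
    _ ≤ 1 := by
        rw [Finset.sum_ite_eq']
        split_ifs <;> norm_num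

theorem abs_le (hF : IsMeanLipschitz n F) {u : ℕ → ℝ} (hu : ∀ k, u k ∈ Icc (0 : ℝ) 1) :
    |F u| ≤ |F 0| + 1 := by
  have hsub : |F u - F 0| ≤ 1 :=
    hF.abs_sub_le zero_le_one fun k _ => abs_sub_le_one (hu k) (by simp)
  have htri := abs_sub_abs_le_abs_sub (F u) (F 0)
  linarith

theorem integrable_comp (hF : IsMeanLipschitz n F) {ψ : ℝ → ℕ → ℝ} (hψm : Measurable ψ)
    (hψ : ∀ x ∈ Icc (0 : ℝ) 1, ∀ k, ψ x k ∈ Icc (0 : ℝ) 1) :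
    Integrable (fun x => F (ψ x)) leb01 :=
  Integrable.of_bound (hF.continuous.measurable.comp hψm).aestronglyMeasurable (|F 0| + 1)
    (ae_mem_Icc.mono fun x hx => hF.abs_le (hψ x hx))

theorem abs_sub_mixOrbit_le (hF : IsMeanLipschitz n F) {u v : ℕ → ℝ} {d : ℝ} (hd : 0 ≤ d)
    (h : ∀ k < n, |u k - v k| ≤ d) (p : ℕ) (x : ℝ) :
    |F (mixOrbit T p u x) - F (mixOrbit T p v x)| ≤ d :=
  hF.abs_sub_le hd fun k hk => by
    unfold mixOrbit
    split_ifs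
    · simpa using hd
    · exact h k hk

end IsMeanLipschitz

theorem measurable_mixOrbit (hT : ∀ j, 1 ≤ j → IsNonsingular (T j)) (i : ℕ) (z : ℕ → ℝ) :
    Measurable (mixOrbit T i z) := by
  refine measurable_pi_lambda _ fun k => ?_
  unfold mixOrbit
  split_ifs
  · exact (IsNonsingular.seqIter hT k).measurable
  · exact measurable_const

theorem mixOrbit_mem (hT : ∀ j, 1 ≤ j → IsNonsingular (T j)) {i : ℕ}
    (hz : ∀ k, z k ∈ Icc (0 : ℝ) 1) {x : ℝ} (hx : x ∈ Icc (0 : ℝ) 1) (k : ℕ) :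
    mixOrbit T i z x k ∈ Icc (0 : ℝ) 1 := by
  unfold mixOrbit
  split_ifs
  · exact (IsNonsingular.seqIter hT k).mapsTo hx
  · exact hz k

theorem measurable_tailOrbit (hT : ∀ j, 1 ≤ j → IsNonsingular (T j)) (p : ℕ) :
    Measurable (tailOrbit T p) :=
  measurable_pi_lambda _ fun k =>
    (IsNonsingular.seqIter (fun j hj => hT (j + p) (Nat.le_add_right_of_le hj)) (k - p)).measurable

theorem tailOrbit_mem (hT : ∀ j, 1 ≤ j → IsNonsingular (T j)) {p : ℕ} {u : ℝ}
    (hu : u ∈ Icc (0 : ℝ) 1) (k : ℕ) : tailOrbit T p u k ∈ Icc (0 : ℝ) 1 :=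
  (IsNonsingular.seqIter (fun j hj => hT (j + p) (Nat.le_add_right_of_le hj)) (k - p)).mapsTo hu

theorem integrable_mixOrbit (hT : ∀ j, 1 ≤ j → IsNonsingular (T j)) (hF : IsMeanLipschitz n F)
    (i : ℕ) (hz : ∀ k, z k ∈ Icc (0 : ℝ) 1) :
    Integrable (fun x => F (mixOrbit T i z x)) leb01 :=
  hF.integrable_comp (measurable_mixOrbit hT i z) fun _ hx => mixOrbit_mem hT hz hx

theorem integrable_orbit (hT : ∀ j, 1 ≤ j → IsNonsingular (T j)) (hF : IsMeanLipschitz n F) :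
    Integrable (fun x => F fun k => seqIter T k x) leb01 :=
  hF.integrable_comp (measurable_pi_lambda _ fun k => (IsNonsingular.seqIter hT k).measurable)
    fun _ hx k => (IsNonsingular.seqIter hT k).mapsTo hx

theorem measurable_tailMean (hT : ∀ j, 1 ≤ j → IsNonsingular (T j)) (hF : IsMeanLipschitz n F)
    (p : ℕ) : Measurable (tailMean T F p) := by
  have hjoint : Measurable fun q : ℝ × ℝ => F (mixOrbit T p (tailOrbit T p q.1) q.2) := by
    refine hF.continuous.measurable.comp (measurable_pi_lambda _ fun k => ?_)
    unfold mixOrbit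
    split_ifs
    · exact (IsNonsingular.seqIter hT k).measurable.comp measurable_snd
    · exact ((measurable_pi_apply k).comp (measurable_tailOrbit hT p)).comp measurable_fst
  exact hjoint.stronglyMeasurable.integral_prod_right'.measurable

theorem integrable_tailMean (hT : ∀ j, 1 ≤ j → IsNonsingular (T j)) (hF : IsMeanLipschitz n F)
    (p : ℕ) : Integrable (fun x => tailMean T F p (seqIter T p x)) leb01 := by
  have hTp := IsNonsingular.seqIter hT p
  refine Integrable.of_bound
    ((measurable_tailMean hT hF p).comp hTp.measurable).aestronglyMeasurable (|F 0| + 1) ?_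
  filter_upwards [ae_mem_Icc] with x hx
  exact abs_integral_le_of_ae_abs_le (ae_mem_Icc.mono fun y hy =>
    hF.abs_le (mixOrbit_mem hT (tailOrbit_mem hT (hTp.mapsTo hx)) hy))

theorem abs_tailMean_sub_integral_mixOrbit_le (hT : ∀ j, 1 ≤ j → IsNonsingular (T j))
    (hF : IsMeanLipschitz n F) {p : ℕ} {u d : ℝ} (hu : u ∈ Icc (0 : ℝ) 1)
    (hz : ∀ k, z k ∈ Icc (0 : ℝ) 1) (hd : 0 ≤ d) (huz : ∀ k < n, |tailOrbit T p u k - z k| ≤ d) :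
    |tailMean T F p u - ∫ y, F (mixOrbit T p z y) ∂leb01| ≤ d := by
  rw [tailMean, ← integral_sub (integrable_mixOrbit hT hF p (tailOrbit_mem hT hu))
    (integrable_mixOrbit hT hF p hz)]
  exact abs_integral_le_of_ae_abs_le
    (Filter.Eventually.of_forall fun y => hF.abs_sub_mixOrbit_le hd huz p y)

theorem abs_tailMean_seqIter_sub_succ_le (hT : ∀ j, 1 ≤ j → IsNonsingular (T j))
    (hF : IsMeanLipschitz n F) (p : ℕ) {x : ℝ} (hx : x ∈ Icc (0 : ℝ) 1) :
    |tailMean T F p (seqIter T p x) - tailMean T F (p + 1) (seqIter T (p + 1) x)| ≤ 1 / n := by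
  have hmem : ∀ p k, tailOrbit T p (seqIter T p x) k ∈ Icc (0 : ℝ) 1 := fun p =>
    tailOrbit_mem hT ((IsNonsingular.seqIter hT p).mapsTo hx)
  rw [tailMean, tailMean, ← integral_sub (integrable_mixOrbit hT hF p (hmem p))
    (integrable_mixOrbit hT hF (p + 1) (hmem (p + 1)))]
  refine abs_integral_le_of_ae_abs_le (ae_mem_Icc.mono fun y hy =>
    hF.abs_sub_le_of_eq_of_ne (i := p) (fun k hk => ?_)
      (abs_sub_le_one (mixOrbit_mem hT (hmem _) hy p) (mixOrbit_mem hT (hmem _) hy p)))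
  rcases hk.lt_or_gt with hk | hk
  · simp only [mixOrbit, hk, hk.trans p.lt_succ_self, if_true]
  · simp only [mixOrbit, hk.not_gt, hk.not_ge, Nat.lt_succ_iff, if_false,
      tailOrbit_seqIter T hk.le, tailOrbit_seqIter T (Nat.succ_le_of_lt hk)]

theorem tailMean_eq_integral (hF : IsMeanLipschitz n F) (u : ℝ) :
    tailMean T F n u = ∫ x, F (fun k => seqIter T k x) ∂leb01 := by
  refine integral_congr_ae (Filter.Eventually.of_forall fun y => ?_)
  refine sub_eq_zero.1 (abs_nonpos_iff.1 (hF.abs_sub_le le_rfl fun k hk => ?_))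
  simp [mixOrbit, hk]

end Orbit

/-! ### Averaging over the past -/

section Past

variable {T : ℕ → ℝ → ℝ} {lam E θ : ℝ} {n : ℕ} {F : (ℕ → ℝ) → ℝ} {z : ℕ → ℝ}

theorem ExpandsUntil.sum_abs_sub_le {i : ℕ} {x y : ℝ} (h : ExpandsUntil T lam i x y)
    (hlam : 1 < lam) :
    ∑ j ∈ Finset.range (i + 1), |seqIter T j x - seqIter T j y| ≤
      lam / (lam - 1) * |seqIter T i x - seqIter T i y| := by
  have hl : 0 < lam - 1 := sub_pos.2 hlam
  have hsplit : lam / (lam - 1) = 1 / (lam - 1) + 1 := by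
    field_simp
    ring
  induction i with
  | zero =>
    rw [zero_add, Finset.sum_range_one, hsplit]
    exact le_mul_of_one_le_left (abs_nonneg _) (le_add_of_nonneg_left (by positivity))
  | succ i ih =>
    calc ∑ j ∈ Finset.range (i + 1 + 1), |seqIter T j x - seqIter T j y|
        ≤ lam / (lam - 1) * |seqIter T i x - seqIter T i y| +
          |seqIter T (i + 1) x - seqIter T (i + 1) y| := by
          rw [Finset.sum_range_succ]
          gcongr
          exact ih fun j hj => h j (Nat.lt_succ_of_lt hj)
      _ = 1 / (lam - 1) * (lam * |seqIter T i x - seqIter T i y|) +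
          |seqIter T (i + 1) x - seqIter T (i + 1) y| := by ring
      _ ≤ 1 / (lam - 1) * |seqIter T (i + 1) x - seqIter T (i + 1) y| +
          |seqIter T (i + 1) x - seqIter T (i + 1) y| := by
          gcongr
          exact h i i.lt_succ_self
      _ = lam / (lam - 1) * |seqIter T (i + 1) x - seqIter T (i + 1) y| := by
          rw [hsplit]
          ring

theorem LipschitzAlong.sub_integral {i : ℕ} {s q : ℝ} {w : ℝ → ℝ}
    (h : LipschitzAlong T lam i s q w) :
    LipschitzAlong T lam i (2 * s) q fun x => w x - ∫ y, w y ∂leb01 where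
  bound x hx := by
    rw [two_mul]
    exact (abs_sub _ _).trans
      (add_le_add (h.bound x hx) (abs_integral_le_of_ae_abs_le (ae_mem_Icc.mono h.bound)))
  lipschitz x hx y hy hxy := by
    rw [sub_sub_sub_cancel_right]
    exact h.lipschitz x hx y hy hxy

theorem IsMeanLipschitz.abs_mixOrbit_sub_le (hF : IsMeanLipschitz n F) (hlam : 1 < lam) {i j : ℕ}
    (hj : j ≤ i + 1) {x y : ℝ} (hxy : ExpandsUntil T lam i x y) :
    |F (mixOrbit T j z x) - F (mixOrbit T j z y)| ≤
      1 / n * (lam / (lam - 1)) * |seqIter T i x - seqIter T i y| := by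
  have hcoord : ∀ k, |mixOrbit T j z x k - mixOrbit T j z y k| =
      if k < j then |seqIter T k x - seqIter T k y| else 0 := fun k => by
    unfold mixOrbit
    split_ifs <;> simp
  rw [mul_assoc]
  refine (hF _ _).trans ?_
  gcongr
  refine le_trans ?_ (hxy.sum_abs_sub_le hlam)
  rw [Finset.sum_congr rfl fun k _ => hcoord k, ← Finset.sum_filter]
  refine Finset.sum_le_sum_of_subset_of_nonneg (fun k hk => ?_) fun _ _ _ => abs_nonneg _
  exact Finset.mem_range.2 ((Finset.mem_filter.1 hk).2.trans_le hj)

theorem IsMeanLipschitz.lipschitzAlong_mixOrbit_succ_sub (hF : IsMeanLipschitz n F)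
    (hT : ∀ j, 1 ≤ j → IsNonsingular (T j)) (hlam : 1 < lam) (hz : ∀ k, z k ∈ Icc (0 : ℝ) 1)
    (i : ℕ) : LipschitzAlong T lam i (1 / n) (2 * (1 / n * (lam / (lam - 1))))
      fun x => F (mixOrbit T (i + 1) z x) - F (mixOrbit T i z x) where
  bound x hx := hF.abs_sub_le_of_eq_of_ne (i := i)
    (fun k hk => by simp only [mixOrbit, Nat.lt_succ_iff_lt_or_eq, hk, or_false])
    (abs_sub_le_one (mixOrbit_mem hT hz hx i) (mixOrbit_mem hT hz hx i))
  lipschitz x _ y _ hxy := by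
    rw [sub_sub_sub_comm, two_mul, add_mul]
    exact (abs_sub _ _).trans (add_le_add (hF.abs_mixOrbit_sub_le hlam le_rfl hxy)
      (hF.abs_mixOrbit_sub_le hlam i.le_succ hxy))

theorem HasDecay.abs_setIntegral_mixOrbit_succ_sub_le (h : HasDecay T lam E θ)
    (hF : IsMeanLipschitz n F) (hz : ∀ k, z k ∈ Icc (0 : ℝ) 1) (i : ℕ) {l : ℕ} (hl : 1 ≤ l)
    {B : Set ℝ} (hB : MeasurableSet B) :
    |∫ x in seqIter T (i + l) ⁻¹' B, ((F (mixOrbit T (i + 1) z x) - F (mixOrbit T i z x)) -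
        ∫ y, (F (mixOrbit T (i + 1) z y) - F (mixOrbit T i z y)) ∂leb01) ∂leb01| ≤
      2 * E * (1 + lam / (lam - 1)) / n * θ ^ l * leb01.real (seqIter T (i + l) ⁻¹' B) := by
  have hint : Integrable (fun x => F (mixOrbit T (i + 1) z x) - F (mixOrbit T i z x)) leb01 :=
    (integrable_mixOrbit h.isNonsingular hF (i + 1) hz).sub
      (integrable_mixOrbit h.isNonsingular hF i hz)
  have hlam : 0 < lam - 1 := sub_pos.2 h.one_lt
  have hlam0 : 0 < lam := one_pos.trans h.one_lt
  refine (h.decay i l hl _ _ _ (hint.sub (integrable_const _)) ?_ (by positivity)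
    (hF.lipschitzAlong_mixOrbit_succ_sub h.isNonsingular h.one_lt hz i).sub_integral B
    hB).trans_eq (by ring)
  exact (integral_sub hint (integrable_const _)).trans (by simp)

theorem setIntegral_sub_sub_integral {f g : ℝ → ℝ} (hf : Integrable f leb01)
    (hg : Integrable g leb01) (Q : Set ℝ) :
    ∫ x in Q, ((f x - g x) - ∫ y, (f y - g y) ∂leb01) ∂leb01 =
      ∫ x in Q, (f x - ∫ y, f y ∂leb01) ∂leb01 - ∫ x in Q, (g x - ∫ y, g y ∂leb01) ∂leb01 := by
  have hf' : IntegrableOn (fun x => f x - ∫ y, f y ∂leb01) Q leb01 :=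
    (hf.sub (integrable_const _)).integrableOn
  have hg' : IntegrableOn (fun x => g x - ∫ y, g y ∂leb01) Q leb01 :=
    (hg.sub (integrable_const _)).integrableOn
  rw [← integral_sub hf' hg', integral_sub hf hg]
  simp only [sub_sub_sub_comm]

theorem sum_range_pow_sub_le (h0 : 0 ≤ θ) (h1 : θ < 1) (p : ℕ) :
    ∑ i ∈ Finset.range p, θ ^ (p - i) ≤ (1 - θ)⁻¹ := calc
  ∑ i ∈ Finset.range p, θ ^ (p - i) ≤ ∑ i ∈ Finset.range (p + 1), θ ^ (p - i) :=
    Finset.sum_le_sum_of_subset_of_nonneg (Finset.range_mono p.le_succ)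
      fun _ _ _ => pow_nonneg h0 _
  _ = ∑ i ∈ Finset.range (p + 1), θ ^ i := Finset.sum_flip fun i => θ ^ i
  _ ≤ (1 - θ)⁻¹ := sum_range_pow_le h0 h1 _

theorem HasDecay.abs_setIntegral_mixOrbit_sub_le (h : HasDecay T lam E θ)
    (hF : IsMeanLipschitz n F) (hz : ∀ k, z k ∈ Icc (0 : ℝ) 1) (p : ℕ) {B : Set ℝ}
    (hB : MeasurableSet B) :
    |∫ x in seqIter T p ⁻¹' B, (F (mixOrbit T p z x) -
        ∫ y, F (mixOrbit T p z y) ∂leb01) ∂leb01| ≤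
      2 * E * (1 + lam / (lam - 1)) * (1 - θ)⁻¹ / n * leb01.real (seqIter T p ⁻¹' B) := by
  set Q := seqIter T p ⁻¹' B
  set K := 2 * E * (1 + lam / (lam - 1)) / n
  set J : ℕ → ℝ := fun i =>
    ∫ x in Q, (F (mixOrbit T i z x) - ∫ y, F (mixOrbit T i z y) ∂leb01) ∂leb01
  have hK : 0 ≤ K := by
    have hlam : 0 < lam - 1 := sub_pos.2 h.one_lt
    have hlam0 : 0 < lam := one_pos.trans h.one_lt
    have hE := h.E_nonneg
    positivity
  have hstart : J 0 = 0 := by simp [J, mixOrbit_zero]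
  have hstep : ∀ i ∈ Finset.range p, |J (i + 1) - J i| ≤ K * θ ^ (p - i) * leb01.real Q := by
    intro i hi
    have hip : i < p := Finset.mem_range.1 hi
    have hdiff := h.abs_setIntegral_mixOrbit_succ_sub_le hF hz i (Nat.sub_pos_of_lt hip) hB
    rwa [Nat.add_sub_cancel' hip.le,
      setIntegral_sub_sub_integral (integrable_mixOrbit h.isNonsingular hF (i + 1) hz)
        (integrable_mixOrbit h.isNonsingular hF i hz)] at hdiff
  calc |J p| = |∑ i ∈ Finset.range p, (J (i + 1) - J i)| := by
        rw [Finset.sum_range_sub, hstart, sub_zero]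
    _ ≤ ∑ i ∈ Finset.range p, K * θ ^ (p - i) * leb01.real Q :=
        (Finset.abs_sum_le_sum_abs _ _).trans (Finset.sum_le_sum hstep)
    _ = K * (∑ i ∈ Finset.range p, θ ^ (p - i)) * leb01.real Q := by
        rw [Finset.mul_sum, Finset.sum_mul]
    _ ≤ K * (1 - θ)⁻¹ * leb01.real Q := by
        gcongr
        exact sum_range_pow_sub_le h.θ_nonneg h.θ_lt_one p
    _ = _ := by ring

end Past

/-! ### Conditioning on the future -/

section Future

variable {T : ℕ → ℝ → ℝ} {lam E θ : ℝ} {n : ℕ} {F : (ℕ → ℝ) → ℝ} {z : ℕ → ℝ}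

theorem abs_setIntegral_le_of_forall_fiber {Ω ι : Type*} [MeasurableSpace Ω] {μ : Measure Ω}
    [IsFiniteMeasure μ] [Countable ι] [MeasurableSpace ι] [MeasurableSingletonClass ι]
    {κ : Ω → ι} (hκ : Measurable κ) {f : Ω → ℝ} (hf : Integrable f μ) {b : ℝ} {Q : Set Ω}
    (hQ : MeasurableSet Q)
    (H : ∀ v, |∫ x in Q ∩ κ ⁻¹' {v}, f x ∂μ| ≤ b * μ.real (Q ∩ κ ⁻¹' {v})) :
    |∫ x in Q, f x ∂μ| ≤ b * μ.real Q := by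
  have hunion : ⋃ v, Q ∩ κ ⁻¹' {v} = Q := by
    rw [← inter_iUnion, ← preimage_iUnion, iUnion_of_singleton, preimage_univ, inter_univ]
  have hsum : ∀ {g : Ω → ℝ}, Integrable g μ →
      HasSum (fun v => ∫ x in Q ∩ κ ⁻¹' {v}, g x ∂μ) (∫ x in Q, g x ∂μ) := fun {g} hg => by
    have h := hasSum_integral_iUnion (f := g) (μ := μ)
      (fun v => hQ.inter (hκ (measurableSet_singleton v)))
      (fun v v' hv => (disjoint_singleton.2 hv).preimage κ |>.mono inter_subset_right
        inter_subset_right) hg.integrableOn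
    rwa [hunion] at h
  have hconst : ∀ s : Set Ω, ∫ _ in s, b ∂μ = b * μ.real s := fun s => by
    rw [setIntegral_const, smul_eq_mul, mul_comm]
  have h := (hsum hf).norm_le_of_bounded (hsum (integrable_const b))
    fun v => (H v).trans_eq (hconst _).symm
  rwa [hconst] at h

theorem abs_setIntegral_le_of_abs_sub_le {Ω : Type*} [MeasurableSpace Ω] {μ : Measure Ω}
    [IsFiniteMeasure μ] {f g : Ω → ℝ} (hf : Integrable f μ) (hg : Integrable g μ) {b d : ℝ}
    {Q : Set Ω} (hQ : MeasurableSet Q) (hd : ∀ᵐ x ∂μ, x ∈ Q → |f x - g x| ≤ d)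
    (hb : |∫ x in Q, g x ∂μ| ≤ b * μ.real Q) : |∫ x in Q, f x ∂μ| ≤ (b + d) * μ.real Q := by
  have hdiff : ‖∫ x in Q, (f x - g x) ∂μ‖ ≤ d * μ.real Q :=
    norm_setIntegral_le_of_norm_le_const_ae (measure_lt_top _ _) ((ae_restrict_iff' hQ).2 hd)
  rw [integral_sub hf.integrableOn hg.integrableOn, Real.norm_eq_abs] at hdiff
  have htri := abs_sub_abs_le_abs_sub (∫ x in Q, f x ∂μ) (∫ x in Q, g x ∂μ)
  linarith

theorem abs_sub_le_of_floor_eq (hn : 0 < n) {s t : ℝ} (hs : 0 ≤ s) (ht : 0 ≤ t)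
    (h : ⌊n * s⌋₊ = ⌊n * t⌋₊) : |s - t| ≤ 1 / n := by
  have hn' : (0 : ℝ) < n := Nat.cast_pos.2 hn
  have hs₁ := Nat.floor_le (mul_nonneg hn'.le hs)
  have hs₂ := Nat.lt_floor_add_one (n * s)
  have ht₁ := Nat.floor_le (mul_nonneg hn'.le ht)
  have ht₂ := Nat.lt_floor_add_one (n * t)
  rw [h] at hs₁ hs₂
  rw [abs_sub_le_iff, le_div_iff₀ hn', le_div_iff₀ hn']
  constructor <;> linarith

theorem abs_orbit_sub_tailMean_sub_le (hT : ∀ j, 1 ≤ j → IsNonsingular (T j))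
    (hF : IsMeanLipschitz n F) {p : ℕ} {x d : ℝ} (hx : x ∈ Icc (0 : ℝ) 1)
    (hz : ∀ k, z k ∈ Icc (0 : ℝ) 1) (hd : 0 ≤ d)
    (hxz : ∀ k < n, |tailOrbit T p (seqIter T p x) k - z k| ≤ d) :
    |((F fun k => seqIter T k x) - tailMean T F p (seqIter T p x)) -
      (F (mixOrbit T p z x) - ∫ y, F (mixOrbit T p z y) ∂leb01)| ≤ 2 * d := by
  rw [sub_sub_sub_comm, two_mul, ← mixOrbit_tailOrbit T p x]
  exact (abs_sub _ _).trans (add_le_add (hF.abs_sub_mixOrbit_le hd hxz p x)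
    (abs_tailMean_sub_integral_mixOrbit_le hT hF ((IsNonsingular.seqIter hT p).mapsTo hx) hz hd
      hxz))

theorem HasDecay.abs_setIntegral_orbit_sub_tailMean_le_of_near (h : HasDecay T lam E θ)
    (hF : IsMeanLipschitz n F) (hz : ∀ k, z k ∈ Icc (0 : ℝ) 1) {p : ℕ} {d : ℝ} (hd : 0 ≤ d)
    {B : Set ℝ} (hB : MeasurableSet B)
    (hBz : ∀ u ∈ B, u ∈ Icc (0 : ℝ) 1 → ∀ k < n, |tailOrbit T p u k - z k| ≤ d) :
    |∫ x in seqIter T p ⁻¹' B,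
        ((F fun k => seqIter T k x) - tailMean T F p (seqIter T p x)) ∂leb01| ≤
      (2 * E * (1 + lam / (lam - 1)) * (1 - θ)⁻¹ / n + 2 * d) *
        leb01.real (seqIter T p ⁻¹' B) := by
  have hTp := IsNonsingular.seqIter h.isNonsingular p
  refine abs_setIntegral_le_of_abs_sub_le
    ((integrable_orbit h.isNonsingular hF).sub (integrable_tailMean h.isNonsingular hF p))
    ((integrable_mixOrbit h.isNonsingular hF p hz).sub (integrable_const _)) (hTp.measurable hB) ?_
    (h.abs_setIntegral_mixOrbit_sub_le hF hz p hB)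
  filter_upwards [ae_mem_Icc] with x hx hxB
  exact abs_orbit_sub_tailMean_sub_le h.isNonsingular hF hx hz hd (hBz _ hxB (hTp.mapsTo hx))

theorem HasDecay.abs_setIntegral_orbit_sub_tailMean_le (h : HasDecay T lam E θ) (hn : 0 < n)
    (hF : IsMeanLipschitz n F) (p : ℕ) {B : Set ℝ} (hB : MeasurableSet B) :
    |∫ x in seqIter T p ⁻¹' B,
        ((F fun k => seqIter T k x) - tailMean T F p (seqIter T p x)) ∂leb01| ≤
      (2 * E * (1 + lam / (lam - 1)) * (1 - θ)⁻¹ + 2) / n *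
        leb01.real (seqIter T p ⁻¹' B) := by
  have hT := h.isNonsingular
  have hTp := IsNonsingular.seqIter hT p
  set code : ℝ → Fin n → ℕ := fun u k => ⌊n * tailOrbit T p u k⌋₊
  have hcode : Measurable code := measurable_pi_lambda _ fun k => Nat.measurable_floor.comp
    (((measurable_pi_apply (k : ℕ)).comp (measurable_tailOrbit hT p)).const_mul _)
  have hnear : ∀ u ∈ Icc (0 : ℝ) 1, ∀ v ∈ Icc (0 : ℝ) 1, code u = code v → ∀ k < n,
      |tailOrbit T p u k - tailOrbit T p v k| ≤ 1 / n := fun u hu v hv huv k hk =>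
    abs_sub_le_of_floor_eq hn (tailOrbit_mem hT hu k).1 (tailOrbit_mem hT hv k).1
      (congrFun huv ⟨k, hk⟩)
  rw [add_div, ← mul_one_div 2]
  refine abs_setIntegral_le_of_forall_fiber (hcode.comp hTp.measurable)
    ((integrable_orbit hT hF).sub (integrable_tailMean hT hF p)) (hTp.measurable hB) fun v => ?_
  rw [preimage_comp, ← preimage_inter]
  have hmeas : MeasurableSet (B ∩ code ⁻¹' {v}) := hB.inter (hcode (measurableSet_singleton v))
  by_cases hv : ∃ u ∈ Icc (0 : ℝ) 1, code u = v
  · obtain ⟨u, hu, rfl⟩ := hv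
    exact h.abs_setIntegral_orbit_sub_tailMean_le_of_near hF (tailOrbit_mem hT hu) (by positivity)
      hmeas fun u' hu' hu'I => hnear u' hu'I u hu hu'.2
  · have hnull : leb01 (seqIter T p ⁻¹' (B ∩ code ⁻¹' {v})) = 0 :=
      measure_eq_zero_iff_ae_notMem.2 (ae_mem_Icc.mono fun x hx hxv =>
        hv ⟨seqIter T p x, hTp.mapsTo hx, hxv.2⟩)
    rw [setIntegral_measure_zero _ hnull, abs_zero, measureReal_def, hnull, ENNReal.toReal_zero,
      mul_zero]

end Future

/-! ### Sub-Gaussian tails -/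

open ProbabilityTheory

section SubGaussian

variable {Ω : Type*} {m m₀ : MeasurableSpace Ω} {μ : Measure Ω}

theorem ae_abs_condExp_le [IsFiniteMeasure μ] (hm : m ≤ m₀) {f : Ω → ℝ} (hf : Integrable f μ)
    {b : ℝ} (H : ∀ s, MeasurableSet[m] s → |∫ x in s, f x ∂μ| ≤ b * μ.real s) :
    ∀ᵐ x ∂μ, |(μ[f | m]) x| ≤ b := by
  have hsm : StronglyMeasurable[m] (μ[f | m]) := stronglyMeasurable_condExp
  have hint : Integrable (μ[f | m]) (μ.trim hm) := integrable_condExp.trim hm hsm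
  have hset : ∀ s, MeasurableSet[m] s →
      ∫ x in s, (μ[f | m]) x ∂(μ.trim hm) = ∫ x in s, f x ∂μ := fun s hs => by
    rw [← setIntegral_trim hm hsm hs, setIntegral_condExp hm hf hs]
  have hconst : ∀ s, MeasurableSet[m] s → ∀ b : ℝ,
      ∫ _ in s, b ∂(μ.trim hm) = b * μ.real s := fun s hs b => by
    rw [← setIntegral_trim hm stronglyMeasurable_const hs, setIntegral_const, smul_eq_mul,
      mul_comm]
  have hup : (μ[f | m]) ≤ᵐ[μ.trim hm] fun _ => b :=
    ae_le_of_forall_setIntegral_le hint (integrable_const _) fun s hs _ => by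
      rw [hset s hs, hconst s hs]
      exact (le_abs_self _).trans (H s hs)
  have hlow : (fun _ => -b) ≤ᵐ[μ.trim hm] (μ[f | m]) :=
    ae_le_of_forall_setIntegral_le (integrable_const _) hint fun s hs _ => by
      rw [hset s hs, hconst s hs, neg_mul]
      exact (abs_le.1 (H s hs)).1
  filter_upwards [ae_le_of_ae_le_trim hup, ae_le_of_ae_le_trim hlow] with x h₁ h₂
  exact abs_le.2 ⟨h₂, h₁⟩

theorem integral_le_sqrt_of_hasSubgaussianMGF [IsProbabilityMeasure μ] {X : Ω → ℝ} {c : ℝ≥0}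
    (hX : HasSubgaussianMGF (fun ω => X ω - ∫ x, X x ∂μ) c μ) (hc : 0 < c)
    (hmean : 0 ≤ ∫ x, X x ∂μ) {A : Set Ω} (hA : 0 < μ A) (hXA : ∀ ω ∈ A, X ω ≤ 0) :
    ∫ x, X x ∂μ ≤ √(2 * c * |Real.log (μ.real A)|) := by
  have hA' : 0 < μ.real A := ENNReal.toReal_pos hA.ne' (measure_ne_top _ _)
  have htail : μ.real A ≤ Real.exp (-(∫ x, X x ∂μ) ^ 2 / (2 * c)) := by
    refine (measureReal_mono fun ω hω => ?_).trans (hX.neg.measure_ge_le hmean)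
    simpa using hXA ω hω
  have hlog := Real.log_le_log hA' htail
  rw [Real.log_exp, neg_div] at hlog
  refine Real.le_sqrt_of_sq_le ?_
  rw [← div_le_iff₀' (by positivity)]
  exact (le_neg.1 hlog).trans (neg_le_abs _)

theorem measureReal_gt_sqrt_add_le_exp [IsProbabilityMeasure μ] {X : Ω → ℝ} {c : ℝ≥0}
    (hX : HasSubgaussianMGF (fun ω => X ω - ∫ x, X x ∂μ) c μ) (hc : 0 < c)
    (hmean : 0 ≤ ∫ x, X x ∂μ) {A : Set Ω} (hA : 0 < μ A) (hXA : ∀ ω ∈ A, X ω ≤ 0)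
    {t : ℝ} (ht : 0 ≤ t) :
    μ.real {ω | X ω > √(2 * c * |Real.log (μ.real A)|) + t} ≤ Real.exp (-t ^ 2 / (2 * c)) := by
  refine (measureReal_mono fun ω hω => ?_).trans (hX.measure_ge_le ht)
  have := integral_le_sqrt_of_hasSubgaussianMGF hX hc hmean hA hXA
  simp only [gt_iff_lt, mem_ofPred_eq] at hω ⊢
  linarith

variable [StandardBorelSpace Ω]

theorem hasCondSubgaussianMGF_of_mem_Icc_of_condExp_eq_zero [IsFiniteMeasure μ] (hm : m ≤ m₀)
    {X : Ω → ℝ} {a b : ℝ} (hX : AEMeasurable X μ) (hab : ∀ᵐ ω ∂μ, X ω ∈ Icc a b)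
    (h0 : μ[X | m] =ᵐ[μ] 0) : HasCondSubgaussianMGF m hm X ((‖b - a‖₊ / 2) ^ 2) μ := by
  have hXi : Integrable X μ := Integrable.of_mem_Icc a b hX hab
  have hint : ∀ᵐ ω ∂μ.trim hm, Integrable X (condExpKernel μ m ω) :=
    Measure.ae_integrable_of_integrable_comp (by rwa [condExpKernel_comp_trim])
  have hmean : ∀ᵐ ω ∂μ.trim hm, ∫ y, X y ∂condExpKernel μ m ω = 0 := by
    have h0' : μ[X | m] =ᵐ[μ.trim hm] 0 :=
      stronglyMeasurable_condExp.ae_eq_trim_of_stronglyMeasurable hm stronglyMeasurable_zero h0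
    filter_upwards [condExp_ae_eq_trim_integral_condExpKernel hm hXi, h0'] with ω h₁ h₂
    rw [← h₁, h₂, Pi.zero_apply]
  have hrange : ∀ᵐ ω ∂μ.trim hm, ∀ᵐ y ∂condExpKernel μ m ω, X y ∈ Icc a b :=
    Measure.ae_ae_of_ae_comp (by rwa [condExpKernel_comp_trim])
  refine ⟨fun t => ?_, ?_⟩
  · rw [condExpKernel_comp_trim]
    exact integrable_exp_mul_of_mem_Icc hX hab
  · filter_upwards [hmean, hrange, hint] with ω h₁ h₂ h₃ t
    exact (hasSubgaussianMGF_of_mem_Icc_of_integral_eq_zero h₃.aemeasurable h₂ h₁).mgf_le t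

theorem hasCondSubgaussianMGF_sub_condExp [IsFiniteMeasure μ] (hm : m ≤ m₀) {X : Ω → ℝ}
    (hX : Integrable X μ) {d : ℝ≥0} (hd : ∀ᵐ ω ∂μ, |X ω - (μ[X | m]) ω| ≤ d) :
    HasCondSubgaussianMGF m hm (fun ω => X ω - (μ[X | m]) ω) (d ^ 2) μ := by
  have h0 : μ[fun ω => X ω - (μ[X | m]) ω | m] =ᵐ[μ] 0 := by
    have h := condExp_sub hX (integrable_condExp (f := X) (m := m)) m
    rwa [condExp_of_stronglyMeasurable hm stronglyMeasurable_condExp integrable_condExp,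
      sub_self] at h
  have h := hasCondSubgaussianMGF_of_mem_Icc_of_condExp_eq_zero hm
    (hX.sub integrable_condExp).aemeasurable (hd.mono fun ω hω => abs_le.1 hω) h0
  have hvar : (‖(d : ℝ) - -(d : ℝ)‖₊ / 2) ^ 2 = d ^ 2 := by
    rw [sub_neg_eq_add, ← two_mul, nnnorm_mul]
    simp
  rwa [hvar] at h

theorem hasSubgaussianMGF_sub_const_of_condExp [IsFiniteMeasure μ] (hm : m ≤ m₀) {X : Ω → ℝ}
    {a : ℝ} {c d : ℝ≥0} (hX : Integrable X μ)
    (hc : HasSubgaussianMGF (fun ω => (μ[X | m]) ω - a) c μ)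
    (hd : ∀ᵐ ω ∂μ, |X ω - (μ[X | m]) ω| ≤ d) :
    HasSubgaussianMGF (fun ω => X ω - a) (c + d ^ 2) μ := by
  have h := HasSubgaussianMGF.add_of_hasCondSubgaussianMGF hm
    (hc.trim hm (stronglyMeasurable_condExp.measurable.sub_const a))
    (hasCondSubgaussianMGF_sub_condExp hm hX hd)
  refine h.congr (Filter.Eventually.of_forall fun ω => ?_)
  simp only [Pi.add_apply]
  ring

theorem hasSubgaussianMGF_condExp_sub_integral [IsProbabilityMeasure μ] {𝓑 : ℕ → MeasurableSpace Ω}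
    (h𝓑 : ∀ p, 𝓑 p ≤ m₀) (hanti : ∀ p, 𝓑 (p + 1) ≤ 𝓑 p) {X : Ω → ℝ} {d : ℝ≥0}
    (hstep : ∀ p, ∀ᵐ ω ∂μ, |(μ[X | 𝓑 p]) ω - (μ[X | 𝓑 (p + 1)]) ω| ≤ d) (n : ℕ)
    (hlast : ∀ᵐ ω ∂μ, |(μ[X | 𝓑 n]) ω - ∫ x, X x ∂μ| ≤ d) :
    HasSubgaussianMGF (fun ω => (μ[X | 𝓑 0]) ω - ∫ x, X x ∂μ) ((n + 1) * d ^ 2) μ := by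
  induction n generalizing 𝓑 with
  | zero =>
    have hbot : μ[μ[X | 𝓑 0] | ⊥] = fun _ => ∫ x, X x ∂μ := by
      rw [condExp_bot, integral_condExp (h𝓑 0)]
    have h0 : HasSubgaussianMGF (fun ω => (μ[μ[X | 𝓑 0] | ⊥]) ω - ∫ x, X x ∂μ) 0 μ := by
      simp [hbot]
    have h := hasSubgaussianMGF_sub_const_of_condExp bot_le integrable_condExp h0 (d := d)
      (by rwa [hbot])
    simpa using h
  | succ n ih =>
    have htower : μ[μ[X | 𝓑 0] | 𝓑 1] =ᵐ[μ] μ[X | 𝓑 1] := condExp_condExp_of_le (hanti 0) (h𝓑 0)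
    have h1 : HasSubgaussianMGF (fun ω => (μ[μ[X | 𝓑 0] | 𝓑 1]) ω - ∫ x, X x ∂μ)
        ((n + 1) * d ^ 2) μ := by
      refine (ih (𝓑 := fun p => 𝓑 (p + 1)) (fun p => h𝓑 (p + 1)) (fun p => hanti (p + 1))
        (fun p => hstep (p + 1)) hlast).congr ?_
      filter_upwards [htower] with ω hω
      rw [hω]
    have h := hasSubgaussianMGF_sub_const_of_condExp (h𝓑 1) integrable_condExp h1 (d := d) (by
      filter_upwards [htower, hstep 0] with ω h₁ h₂
      rwa [h₁])
    convert h using 1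
    push_cast
    ring

end SubGaussian

/-! ### Concentration -/

section Concentration

variable {T : ℕ → ℝ → ℝ} {lam E θ : ℝ} {A : Set ℝ} {n : ℕ} {F : (ℕ → ℝ) → ℝ}

theorem HasDecay.exists_ae_abs_condExp_sub_tailMean_le (h : HasDecay T lam E θ) :
    ∃ K : ℝ≥0, ∀ n F, 0 < n → IsMeanLipschitz n F → ∀ p,
      ∀ᵐ x ∂leb01, |(leb01[fun x => F fun k => seqIter T k x |
        MeasurableSpace.comap (seqIter T p) inferInstance]) x - tailMean T F p (seqIter T p x)| ≤
          K / n := by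
  have hlam : 0 < lam - 1 := sub_pos.2 h.one_lt
  have hlam0 : 0 < lam := one_pos.trans h.one_lt
  have hθ : 0 < 1 - θ := sub_pos.2 h.θ_lt_one
  have hE := h.E_nonneg
  refine ⟨⟨2 * E * (1 + lam / (lam - 1)) * (1 - θ)⁻¹ + 2, by positivity⟩,
    fun n F hn hF p => ?_⟩
  have hSm : Measurable (seqIter T p) := (IsNonsingular.seqIter h.isNonsingular p).measurable
  have hZ := integrable_orbit h.isNonsingular hF
  have hG := integrable_tailMean h.isNonsingular hF p
  have hGm : Measurable[MeasurableSpace.comap (seqIter T p) inferInstance]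
      fun x => tailMean T F p (seqIter T p x) :=
    (measurable_tailMean h.isNonsingular hF p).comp (comap_measurable _)
  have hsub := condExp_sub hZ hG (MeasurableSpace.comap (seqIter T p) inferInstance)
  rw [condExp_of_stronglyMeasurable hSm.comap_le hGm.stronglyMeasurable hG] at hsub
  have hle := ae_abs_condExp_le hSm.comap_le (hZ.sub hG) (by
    rintro _ ⟨B, hB, rfl⟩
    exact h.abs_setIntegral_orbit_sub_tailMean_le hn hF p hB)
  filter_upwards [hle, hsub] with x hx hx'
  rwa [hx'] at hx

theorem hasSubgaussianMGF_mono {Ω : Type*} [MeasurableSpace Ω] {μ : Measure Ω} {X : Ω → ℝ}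
    {c c' : ℝ≥0} (h : HasSubgaussianMGF X c μ) (hc : c ≤ c') : HasSubgaussianMGF X c' μ where
  integrable_exp_mul := h.integrable_exp_mul
  mgf_le t := (h.mgf_le t).trans (Real.exp_le_exp.2 (by gcongr))

theorem comap_seqIter_succ_le (hT : ∀ j, 1 ≤ j → IsNonsingular (T j)) (p : ℕ) :
    MeasurableSpace.comap (seqIter T (p + 1)) inferInstance ≤
      MeasurableSpace.comap (seqIter T p) inferInstance := by
  rintro _ ⟨B, hB, rfl⟩
  exact ⟨T (p + 1) ⁻¹' B, (hT _ p.succ_pos).measurable hB, rfl⟩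

theorem condExp_comap_seqIter_zero (hT : ∀ j, 1 ≤ j → IsNonsingular (T j))
    (hF : IsMeanLipschitz n F) :
    leb01[fun x => F fun k => seqIter T k x | MeasurableSpace.comap (seqIter T 0) inferInstance] =
      fun x => F fun k => seqIter T k x := by
  have hm : Measurable fun x => F fun k => seqIter T k x :=
    hF.continuous.measurable.comp
      (measurable_pi_lambda _ fun k => (IsNonsingular.seqIter hT k).measurable)
  rw [seqIter, MeasurableSpace.comap_id]
  exact condExp_of_stronglyMeasurable le_rfl hm.stronglyMeasurable (integrable_orbit hT hF)

theorem HasDecay.exists_hasSubgaussianMGF (h : HasDecay T lam E θ) :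
    ∃ c : ℝ≥0, 0 < c ∧ ∀ n F, 0 < n → IsMeanLipschitz n F →
      HasSubgaussianMGF (fun x => (F fun k => seqIter T k x) -
        ∫ y, F (fun k => seqIter T k y) ∂leb01) (c / n) leb01 := by
  obtain ⟨K, hK⟩ := h.exists_ae_abs_condExp_sub_tailMean_le
  refine ⟨2 * (2 * K + 1) ^ 2, by positivity, fun n F hn hF => ?_⟩
  let 𝓑 : ℕ → MeasurableSpace ℝ := fun p => MeasurableSpace.comap (seqIter T p) inferInstance
  have hT := h.isNonsingular
  have h𝓑 : ∀ p, 𝓑 p ≤ Real.measurableSpace := fun p =>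
    (IsNonsingular.seqIter hT p).measurable.comap_le
  have hd : (((2 * K + 1) / n : ℝ≥0) : ℝ) = K / n + 1 / n + K / n := by
    push_cast
    ring
  have hstep : ∀ p, ∀ᵐ x ∂leb01, |(leb01[fun x => F fun k => seqIter T k x | 𝓑 p]) x -
      (leb01[fun x => F fun k => seqIter T k x | 𝓑 (p + 1)]) x| ≤ ((2 * K + 1) / n : ℝ≥0) := by
    intro p
    filter_upwards [hK n F hn hF p, hK n F hn hF (p + 1), ae_mem_Icc] with x hx hx' hxI
    have hmean := abs_tailMean_seqIter_sub_succ_le hT hF p hxI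
    rw [abs_sub_comm] at hx'
    rw [hd]
    exact (abs_sub_le _ _ _).trans (add_le_add ((abs_sub_le _ _ _).trans (add_le_add hx hmean)) hx')
  have hlast : ∀ᵐ x ∂leb01, |(leb01[fun x => F fun k => seqIter T k x | 𝓑 n]) x -
      ∫ y, F (fun k => seqIter T k y) ∂leb01| ≤ ((2 * K + 1) / n : ℝ≥0) := by
    filter_upwards [hK n F hn hF n] with x hx
    rw [tailMean_eq_integral hF] at hx
    rw [hd, add_assoc]
    exact hx.trans (le_add_of_nonneg_right (by positivity))
  have hsub := hasSubgaussianMGF_condExp_sub_integral h𝓑 (comap_seqIter_succ_le hT) hstep n hlast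
  rw [condExp_comap_seqIter_zero hT hF] at hsub
  refine hasSubgaussianMGF_mono hsub ?_
  have hn1 : (1 : ℝ≥0) ≤ n := Nat.one_le_cast.2 hn
  calc ((n : ℝ≥0) + 1) * ((2 * K + 1) / n) ^ 2 ≤ (n + n) * ((2 * K + 1) / n) ^ 2 := by gcongr
    _ = 2 * (2 * K + 1) ^ 2 / n := by
      field_simp
      ring

/-- The mean distance of the sequence `u` to the orbits that start in `A`, up to time `n`, so that
`shadow T A n` is its value on orbits. -/
noncomputable def orbitDist (T : ℕ → ℝ → ℝ) (A : Set ℝ) (n : ℕ) (u : ℕ → ℝ) : ℝ :=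
  ⨅ y : A, 1 / (n : ℝ) * ∑ k ∈ Finset.range n, |u k - seqIter T k y|

theorem bddBelow_orbitDist (T : ℕ → ℝ → ℝ) (A : Set ℝ) (n : ℕ) (u : ℕ → ℝ) :
    BddBelow (range fun y : A => 1 / (n : ℝ) * ∑ k ∈ Finset.range n, |u k - seqIter T k y|) :=
  ⟨0, forall_mem_range.2 fun _ => by positivity⟩

theorem orbitDist_le_add (T : ℕ → ℝ → ℝ) (hA : A.Nonempty) (n : ℕ) (u v : ℕ → ℝ) :
    orbitDist T A n u ≤ orbitDist T A n v + 1 / n * ∑ k ∈ Finset.range n, |u k - v k| := by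
  have := hA.to_subtype
  refine sub_le_iff_le_add.1 (le_ciInf fun y => sub_le_iff_le_add.2 ?_)
  refine (ciInf_le (bddBelow_orbitDist T A n u) y).trans ?_
  rw [← mul_add, ← Finset.sum_add_distrib]
  gcongr with k
  exact (abs_sub_le _ (v k) _).trans_eq (add_comm _ _)

theorem isMeanLipschitz_orbitDist (T : ℕ → ℝ → ℝ) (hA : A.Nonempty) (n : ℕ) :
    IsMeanLipschitz n (orbitDist T A n) := by
  refine fun u v => abs_sub_le_iff.2 ⟨sub_le_iff_le_add'.2 (orbitDist_le_add T hA n u v),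
    sub_le_iff_le_add'.2 ?_⟩
  simp only [abs_sub_comm (u _)]
  exact orbitDist_le_add T hA n v u

theorem shadow_nonneg (T : ℕ → ℝ → ℝ) (A : Set ℝ) (n : ℕ) (x : ℝ) : 0 ≤ shadow T A n x :=
  Real.iInf_nonneg fun _ => by positivity

theorem shadow_eq_zero (T : ℕ → ℝ → ℝ) (n : ℕ) {x : ℝ} (hx : x ∈ A) : shadow T A n x = 0 := by
  refine le_antisymm ((ciInf_le (bddBelow_orbitDist T A n _) ⟨x, hx⟩).trans_eq ?_)
    (shadow_nonneg T A n x)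
  simp

theorem HasDecay.shadow_concentration (h : HasDecay T lam E θ) :
    ∃ C₁ C₂ : ℝ, 0 < C₁ ∧ 0 < C₂ ∧ ∀ A : Set ℝ, 0 < leb01 A → ∀ n : ℕ, 1 ≤ n →
      ∀ t : ℝ, 0 < t →
        leb01.real {x | shadow T A n x >
            C₁ * (√|Real.log (leb01.real A)| / √n) + t / √n} ≤ Real.exp (-C₂ * t ^ 2) := by
  obtain ⟨c, hc, hsub⟩ := h.exists_hasSubgaussianMGF
  refine ⟨√(2 * c), 1 / (2 * c), by positivity, by positivity, fun A hA n hn t ht => ?_⟩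
  have hn' : (0 : ℝ≥0) < n := Nat.cast_pos.2 hn
  have hF := isMeanLipschitz_orbitDist T (nonempty_of_measure_ne_zero hA.ne') n
  have htail := measureReal_gt_sqrt_add_le_exp (X := shadow T A n) (hsub n _ hn hF)
    (div_pos hc hn') (integral_nonneg (shadow_nonneg T A n)) hA
    (fun x hx => (shadow_eq_zero T n hx).le) (t := t / √n) (by positivity)
  have hsqrt : √(2 * (c / n : ℝ≥0) * |Real.log (leb01.real A)|) =
      √(2 * c) * (√|Real.log (leb01.real A)| / √n) := by
    rw [← Real.sqrt_div (abs_nonneg _), ← Real.sqrt_mul (by positivity)]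
    push_cast
    congr 1
    ring
  have hexp : -(t / √n) ^ 2 / (2 * (c / n : ℝ≥0)) = -(1 / (2 * c)) * t ^ 2 := by
    rw [div_pow, Real.sq_sqrt n.cast_nonneg]
    push_cast
    have hnR : (n : ℝ) ≠ 0 := by positivity
    field_simp
  rwa [hsqrt, hexp] at htail

end Concentration

end SeqDyn

theorem mainTheorem5_general {C : Set (ℝ → ℝ)} {lam M : ℝ} {N : ℕ} (hlam : 1 < lam) (hM : 0 ≤ M)
    (hC : ∀ S ∈ C, SeqDyn.IsPiecewiseExpanding S lam M N) (hdec : SeqDyn.ConditionDec C)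
    {T : ℕ → ℝ → ℝ} (hT : ∀ n, 1 ≤ n → T n ∈ C) (hmin : SeqDyn.ConditionMin T) :
    ∃ C₁ C₂ : ℝ, 0 < C₁ ∧ 0 < C₂ ∧
      ∀ A : Set ℝ, 0 < SeqDyn.leb01 A → ∀ n : ℕ, 1 ≤ n → ∀ t : ℝ, 0 < t →
        SeqDyn.leb01.real {x | SeqDyn.shadow T A n x >
            C₁ * (√|Real.log (SeqDyn.leb01.real A)| / √n) + t / √n} ≤ Real.exp (-C₂ * t ^ 2) := by
  obtain ⟨E, θ, h⟩ := SeqDyn.exists_hasDecay hlam hM hC hdec hT hmin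
  exact h.shadow_concentration

theorem mainTheorem5 (C : Set (ℝ → ℝ)) (hC : SeqDyn.IsAdmissibleClass C)
    (T : ℕ → ℝ → ℝ) (hT : ∀ n, 1 ≤ n → T n ∈ C) (hmin : SeqDyn.ConditionMin T) :
    ∃ C₁ C₂ : ℝ, 0 < C₁ ∧ 0 < C₂ ∧
      ∀ A : Set ℝ, MeasurableSet A → A ⊆ Set.Icc 0 1 → 0 < SeqDyn.leb01 A →
        ∀ n : ℕ, 1 ≤ n → ∀ t : ℝ, 0 < t →
          SeqDyn.leb01.real {x | SeqDyn.shadow T A n x >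
              C₁ * (Real.sqrt |Real.log (SeqDyn.leb01.real A)| / Real.sqrt n)
                + t / Real.sqrt n}
            ≤ Real.exp (-C₂ * t ^ 2) := by
  obtain ⟨lam, M, N, hlam, hM, -, hunif⟩ := hC.uniform
  have hexp : ∀ S ∈ C, SeqDyn.IsPiecewiseExpanding S lam M N := fun S hS =>
    let ⟨_, _, hk, hC2, hb⟩ := hunif S hS
    hC2.isPiecewiseExpanding hlam.le hk hb
  obtain ⟨C₁, C₂, hC₁, hC₂, H⟩ :=
    mainTheorem5_general hlam (zero_le_one.trans hM) hexp hC.condDec hT hmin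
  exact ⟨C₁, C₂, hC₁, hC₂, fun A _ _ hA => H A hA⟩
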